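/- Conventions. Manifolds are $C^\infty$, connected, Hausdorff and second countable, without boundary. $\mathbb{L}^{m+1}$ is $\mathbb{R}^{m+1}$ with the Lorentz product $\langle x,y\rangle=\sum_{i\le m}x_iy_i-x_{m+1}y_{m+1}$. For $c>0$ put $$\mathbb{H}^m(-c)=\{X\in\mathbb{L}^{m+1}:\langle X,X\rangle=-1/c,\ X_{m+1}>0\},\qquad \mathbb{S}^m(c)=\{Y\in\mathbb{R}^{m+1}:\langle Y,Y\rangle=1/c\},$$ with the induced metrics. An inversion of $\mathbb{R}^N$ is a map $x\mapsto b+s^2(x-b)/\|x-b\|^2$, $x\neq b$, with $b\in\mathbb{R}^N$ and $s>0$; a homothety is a map $x\mapsto a+r(x-a)$ with $a\in\mathbb{R}^N$ and $r>0$. The maps $\Theta$. Let $m+n=N$ with $m,n\ge 1$. Choose light-like vectors $p_0,w\in\mathbb{L}^{N+2}$ with $\langle p_0,w\rangle=1$ and a linear isometry $A$ of $\mathbb{R}^N$ onto $\mathrm{span}\{p_0,w\}^\perp$; then $\Psi(x)=p_0+Ax-\tfrac12\|x\|^2w$ is an isometry of $\mathbb{R}^N$ onto $\{p\in\mathbb{L}^{N+2}:\langle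 p,p\rangle=0,\ \langle p,w\rangle=1\}$. Choose further an orthogonal decomposition $\mathbb{L}^{N+2}=V\oplus W$ with $V$ time-like and linear isometries $C:\mathbb{L}^{m+1}\to V$, $D:\mathbb{R}^{n+1}\to W$. These data define $$\Theta(X,Y)=\Psi^{-1}\left(\frac{CX+DY}{\langle CX+DY,w\rangle}\right)$$ at all $(X,Y)\in\mathbb{H}^m(-c)\times\mathbb{S}^n(c)$ with $\langle CX+DY,w\rangle\ne0$, that is, at all points of $\mathbb{H}^m(-c)\times\mathbb{S}^n(c)$ except at most one. Corollary 4.4. Let $k\ge2$, let $M_1^{N_1},\dots,M_k^{N_k}$ be Riemannian manifolds of dimensions $N_i\ge1$, let $N=N_1+\dots+N_k\ge3$, and let $f:M^N=\prod_{i=1}^kM_i^{N_i}\to\mathbb{R}^N$ be a conformal local diffeomorphism of the Riemannian product. Then one of the following holds: (i) There exist local isometries $f_i:M_i^{N_i}\to\mathbb{R}^{N_i}$ $(1\le i\le k)$, an isometry $\Phi:\prod_{i=1}^k\mathbb{R}^{N_i}\to\mathbb{R}^N$, a homothety $H$ of $\mathbb{R}^N$ and a map $I$, which is either the identity of $\mathbb{R}^N$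 or an inversion of $\mathbb{R}^N$ whose centre is not in the image of $H\circ\Phi\circ(f_1\times\dots\times f_k)$, such that $f=I\circ H\circ\Phi\circ(f_1\times\dots\times f_k)$. (ii) $k=2$ and, after relabelling the factors if necessary, there exist $c>0$, local isometries $f_1:M_1^{N_1}\to\mathbb{H}^{N_1}(-c)$ and $f_2:M_2^{N_2}\to\mathbb{S}^{N_2}(c)$, and a map $\Theta$ as above (with $m=N_1$, $n=N_2$), which is a conformal diffeomorphism of its domain onto an open subset of $\mathbb{R}^N$, such that the image of $f_1\times f_2$ lies in the domain of $\Theta$ and $f=\Theta\circ(f_1\times f_2)$. -/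

import Mathlib

open scoped Manifold ContDiff

noncomputable section

/-- A smooth Riemannian metric on an `n`-dimensional manifold (without boundary). -/
abbrev RiemMetric (n : ℕ) (M : Type*) [TopologicalSpace M]
    [ChartedSpace (EuclideanSpace ℝ (Fin n)) M] [IsManifold (𝓡 n) ∞ M] : Type _ :=
  Bundle.ContMDiffRiemannianMetric (𝓡 n) ∞ (EuclideanSpace ℝ (Fin n))
    (fun x : M => TangentSpace (𝓡 n) x)

/-- The model with corners (in fact without boundary) of a finite product of manifolds of
dimensions `n i`; the product itself is `∀ i, M i` with Mathlib's product charts. -/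
abbrev prodModel {k : ℕ} (n : Fin k → ℕ) :
    ModelWithCorners ℝ (∀ i, EuclideanSpace ℝ (Fin (n i)))
      (ModelPi fun i => EuclideanSpace ℝ (Fin (n i))) :=
  ModelWithCorners.pi fun i => 𝓡 (n i)

/-- The Riemannian product metric `∑ i, πᵢ^* gᵢ` on `∀ i, M i`, where `πᵢ` is the projection
onto the `i`-th factor. -/
def productMetric {k : ℕ} {n : Fin k → ℕ} {M : Fin k → Type*}
    [∀ i, TopologicalSpace (M i)] [∀ i, ChartedSpace (EuclideanSpace ℝ (Fin (n i))) (M i)]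
    [∀ i, IsManifold (𝓡 (n i)) ∞ (M i)] (g : ∀ i, RiemMetric (n i) (M i))
    (p : ∀ i, M i) (u v : TangentSpace (prodModel n) p) : ℝ :=
  ∑ i, (g i).inner (p i)
    (mfderiv (prodModel n) (𝓡 (n i)) (fun q : ∀ j, M j => q i) p u)
    (mfderiv (prodModel n) (𝓡 (n i)) (fun q : ∀ j, M j => q i) p v)

/-- A conformal local diffeomorphism from the Riemannian product of the `(M i, g i)` into `ℝ^N`:
a smooth local diffeomorphism with `⟪df u, df v⟫ = φ² ⟨u, v⟩` for a positive function `φ`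
(which is then automatically smooth). -/
structure IsConformalLocalDiffeo {k : ℕ} {n : Fin k → ℕ} {M : Fin k → Type*}
    [∀ i, TopologicalSpace (M i)] [∀ i, ChartedSpace (EuclideanSpace ℝ (Fin (n i))) (M i)]
    [∀ i, IsManifold (𝓡 (n i)) ∞ (M i)] (g : ∀ i, RiemMetric (n i) (M i)) {N : ℕ}
    (f : (∀ i, M i) → EuclideanSpace ℝ (Fin N)) : Prop where
  isLocalDiffeomorph : IsLocalDiffeomorph (prodModel n) (𝓡 N) ∞ f
  conformal : ∃ φ : (∀ i, M i) → ℝ, (∀ p, 0 < φ p) ∧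
    ∀ (p : ∀ i, M i) (u v : TangentSpace (prodModel n) p),
      inner ℝ (mvfderiv (prodModel n) f p u) (mvfderiv (prodModel n) f p v)
        = φ p ^ 2 * productMetric g p u v

/-- A local isometry from an `n`-dimensional Riemannian manifold into Euclidean `ℝ^n`. -/
structure IsLocalIsometryEuclidean {n : ℕ} {M : Type*} [TopologicalSpace M]
    [ChartedSpace (EuclideanSpace ℝ (Fin n)) M] [IsManifold (𝓡 n) ∞ M] (g : RiemMetric n M)
    (h : M → EuclideanSpace ℝ (Fin n)) : Prop where
  isLocalDiffeomorph : IsLocalDiffeomorph (𝓡 n) (𝓡 n) ∞ h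
  isometric : ∀ (x : M) (u v : TangentSpace (𝓡 n) x),
    inner ℝ (mvfderiv (𝓡 n) h x u) (mvfderiv (𝓡 n) h x v) = g.inner x u v

/-! ### Minkowski space, hyperbolic spaces and spheres -/

/-- The underlying vector space `ℝ^(m+1)` of the Minkowski space `𝕃^(m+1)`. -/
abbrev Minkowski (m : ℕ) : Type := EuclideanSpace ℝ (Fin (m + 1))

/-- The Lorentz scalar product, of signature `(+, …, +, -)`. -/
def lorentz {m : ℕ} (x y : Minkowski m) : ℝ :=
  ∑ i : Fin m, x i.castSucc * y i.castSucc - x (Fin.last m) * y (Fin.last m)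

theorem lorentz_comm {m : ℕ} (x y : Minkowski m) : lorentz x y = lorentz y x := by
  simp only [lorentz, mul_comm]

theorem lorentz_add_left {m : ℕ} (x y z : Minkowski m) :
    lorentz (x + y) z = lorentz x z + lorentz y z := by
  simp only [lorentz, PiLp.add_apply, add_mul, Finset.sum_add_distrib]
  ring

theorem lorentz_smul_left {m : ℕ} (a : ℝ) (x y : Minkowski m) :
    lorentz (a • x) y = a * lorentz x y := by
  simp only [lorentz, PiLp.smul_apply, smul_eq_mul, mul_sub, Finset.mul_sum, mul_assoc]

theorem lorentz_add_right {m : ℕ} (x y z : Minkowski m) :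
    lorentz x (y + z) = lorentz x y + lorentz x z := by
  rw [lorentz_comm, lorentz_add_left, lorentz_comm y, lorentz_comm z]

theorem lorentz_smul_right {m : ℕ} (a : ℝ) (x y : Minkowski m) :
    lorentz x (a • y) = a * lorentz x y := by
  rw [lorentz_comm, lorentz_smul_left, lorentz_comm]

/-- The hyperbolic space `ℍ^m(-c)`: the sheet `x_{m+1} > 0` of `⟨x, x⟩ = -1/c` in `𝕃^(m+1)`. -/
def hyperbolic (m : ℕ) (c : ℝ) : Set (Minkowski m) :=
  {x | lorentz x x = -1 / c ∧ 0 < x (Fin.last m)}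

/-- The sphere `𝕊^n(c)`, given by `⟪y, y⟫ = 1/c` in `ℝ^(n+1)`. -/
def roundSphere (n : ℕ) (c : ℝ) : Set (EuclideanSpace ℝ (Fin (n + 1))) :=
  {y | inner ℝ y y = 1 / c}

/-- A local isometry from an `n`-dimensional Riemannian manifold `M` into `ℍ^n(-c)`. As `ℍ^n(-c)`
is an embedded hypersurface of `𝕃^(n+1)` whose metric is the restriction of the Lorentz product,
this is a smooth map into `𝕃^(n+1)` which takes its values in `ℍ^n(-c)` and pulls the Lorentz
product back to the metric of `M`; it is a local diffeomorphism onto `ℍ^n(-c)` since the two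
dimensions agree. -/
structure IsLocalIsometryHyperbolic {n : ℕ} {M : Type*} [TopologicalSpace M]
    [ChartedSpace (EuclideanSpace ℝ (Fin n)) M] [IsManifold (𝓡 n) ∞ M] (g : RiemMetric n M)
    (c : ℝ) (h : M → Minkowski n) : Prop where
  mem : ∀ x, h x ∈ hyperbolic n c
  contMDiff : ContMDiff (𝓡 n) 𝓘(ℝ, Minkowski n) ∞ h
  isometric : ∀ (x : M) (u v : TangentSpace (𝓡 n) x),
    lorentz (mvfderiv (𝓡 n) h x u) (mvfderiv (𝓡 n) h x v) = g.inner x u v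

/-- A local isometry from an `n`-dimensional Riemannian manifold `M` into `𝕊^n(c)`, seen as an
embedded hypersurface of `ℝ^(n+1)` with the induced metric. -/
structure IsLocalIsometrySphere {n : ℕ} {M : Type*} [TopologicalSpace M]
    [ChartedSpace (EuclideanSpace ℝ (Fin n)) M] [IsManifold (𝓡 n) ∞ M] (g : RiemMetric n M)
    (c : ℝ) (h : M → EuclideanSpace ℝ (Fin (n + 1))) : Prop where
  mem : ∀ x, h x ∈ roundSphere n c
  contMDiff : ContMDiff (𝓡 n) 𝓘(ℝ, EuclideanSpace ℝ (Fin (n + 1))) ∞ h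
  isometric : ∀ (x : M) (u v : TangentSpace (𝓡 n) x),
    inner ℝ (mvfderiv (𝓡 n) h x u) (mvfderiv (𝓡 n) h x v) = g.inner x u v

/-! ### Euclidean space in the light cone -/

/-- A triple `(p₀, w, A)`: `w` is light-like, `p₀` is light-like with `⟨p₀, w⟩ = 1`, and `A` is a
linear isometry from `ℝ^N` onto the orthogonal complement of `span {p₀, w}` in `𝕃^(N+2)` (it is
onto by dimension). -/
structure LightConeTriple (N : ℕ) where
  p₀ : Minkowski (N + 1)
  w : Minkowski (N + 1)
  A : EuclideanSpace ℝ (Fin N) →ₗ[ℝ] Minkowski (N + 1)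
  lorentz_w_w : lorentz w w = 0
  lorentz_p₀_p₀ : lorentz p₀ p₀ = 0
  lorentz_p₀_w : lorentz p₀ w = 1
  lorentz_A : ∀ x y, lorentz (A x) (A y) = inner ℝ x y
  lorentz_A_p₀ : ∀ x, lorentz (A x) p₀ = 0
  lorentz_A_w : ∀ x, lorentz (A x) w = 0

/-- The isometry `Ψ(x) = p₀ + A x - ½ ‖x‖² w` of `ℝ^N` onto the hypersurface
`𝔼^N = {p | ⟨p, p⟩ = 0, ⟨p, w⟩ = 1}` of the light cone. -/
def LightConeTriple.embed {N : ℕ} (T : LightConeTriple N) (x : EuclideanSpace ℝ (Fin N)) :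
    Minkowski (N + 1) :=
  T.p₀ + T.A x - (1 / 2 * ‖x‖ ^ 2 : ℝ) • T.w

/-- For a light-like vector `z` with `⟨z, w⟩ ≠ 0`, the point `x` of `ℝ^N` such that
`Ψ(x) = z / ⟨z, w⟩` (see `embed_toEuclidean`): its coordinates are those of `z / ⟨z, w⟩` with
respect to the orthonormal vectors `A e_j`. -/
def LightConeTriple.toEuclidean {N : ℕ} (T : LightConeTriple N) (z : Minkowski (N + 1)) :
    EuclideanSpace ℝ (Fin N) :=
  WithLp.toLp 2 fun j => lorentz z (T.A (EuclideanSpace.single j 1)) / lorentz z T.w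

theorem LightConeTriple.exists_decomp {N : ℕ} (T : LightConeTriple N) (z : Minkowski (N + 1)) :
    ∃ (a b : ℝ) (x : EuclideanSpace ℝ (Fin N)), z = a • T.p₀ + b • T.w + T.A x := by
  let L : (ℝ × ℝ) × EuclideanSpace ℝ (Fin N) →ₗ[ℝ] Minkowski (N + 1) :=
    ((LinearMap.toSpanSingleton ℝ _ T.p₀).coprod (LinearMap.toSpanSingleton ℝ _ T.w)).coprod T.A
  have hL : ∀ a b x, L ((a, b), x) = a • T.p₀ + b • T.w + T.A x := fun a b x => by
    simp [L, LinearMap.coprod_apply, LinearMap.toSpanSingleton_apply]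
  have hinj : Function.Injective L := by
    rw [injective_iff_map_eq_zero]
    rintro ⟨⟨a, b⟩, x⟩ h
    rw [hL] at h
    have hz : ∀ y, lorentz (a • T.p₀ + b • T.w + T.A x) y = 0 := fun y => by
      rw [h]; simp [lorentz]
    have ha : a = 0 := by
      simpa [lorentz_add_left, lorentz_smul_left, T.lorentz_p₀_w, T.lorentz_w_w, T.lorentz_A_w]
        using hz T.w
    have hb : b = 0 := by
      simpa [lorentz_add_left, lorentz_smul_left, lorentz_comm T.w T.p₀, T.lorentz_p₀_w,
        T.lorentz_p₀_p₀, T.lorentz_A_p₀] using hz T.p₀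
    have hx : x = 0 := by
      have := hz (T.A x)
      rw [ha, hb] at this
      simpa [T.lorentz_A] using this
    simp [ha, hb, hx]
  have hsurj : Function.Surjective L :=
    (LinearMap.injective_iff_surjective_of_finrank_eq_finrank (by simp; omega)).1 hinj
  obtain ⟨⟨⟨a, b⟩, x⟩, h⟩ := hsurj z
  exact ⟨a, b, x, by rw [← h, hL]⟩

theorem LightConeTriple.embed_toEuclidean {N : ℕ} (T : LightConeTriple N) {z : Minkowski (N + 1)}
    (hz : lorentz z z = 0) (hw : lorentz z T.w ≠ 0) :
    T.embed (T.toEuclidean z) = (lorentz z T.w)⁻¹ • z := by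
  obtain ⟨a, b, x, rfl⟩ := T.exists_decomp z
  have h1 : lorentz (a • T.p₀ + b • T.w + T.A x) T.w = a := by
    simp [lorentz_add_left, lorentz_smul_left, T.lorentz_p₀_w, T.lorentz_w_w, T.lorentz_A_w]
  have h2 : ∀ y, lorentz (a • T.p₀ + b • T.w + T.A x) (T.A y) = inner ℝ x y := fun y => by
    simp [lorentz_add_left, lorentz_smul_left, lorentz_comm T.p₀, lorentz_comm T.w,
      T.lorentz_A_w, T.lorentz_A_p₀, T.lorentz_A]
  have h3 : T.toEuclidean (a • T.p₀ + b • T.w + T.A x) = a⁻¹ • x := by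
    ext j
    simp only [LightConeTriple.toEuclidean, h1, h2]
    simp [EuclideanSpace.inner_single_right, div_eq_inv_mul]
  have h4 : 2 * a * b + ‖x‖ ^ 2 = 0 := by
    rw [← real_inner_self_eq_norm_sq, ← hz]
    simp only [lorentz_add_left, lorentz_add_right, lorentz_smul_left, lorentz_smul_right,
      T.lorentz_A, T.lorentz_A_w, T.lorentz_A_p₀, T.lorentz_p₀_p₀, T.lorentz_w_w, T.lorentz_p₀_w,
      lorentz_comm T.p₀ (T.A x), lorentz_comm T.w (T.A x), lorentz_comm T.w T.p₀]
    ring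
  rw [h1] at hw ⊢
  rw [h3, LightConeTriple.embed, norm_smul, map_smul, smul_add, smul_add, smul_smul, smul_smul,
    inv_mul_cancel₀ hw, one_smul]
  have h5 : -(1 / 2 * (‖a⁻¹‖ * ‖x‖) ^ 2) = a⁻¹ * b := by
    rw [mul_pow, Real.norm_eq_abs, sq_abs]
    field_simp
    linarith
  rw [← h5, neg_smul]
  abel

/-- An orthogonal decomposition `𝕃^(N+2) = V ⊕ W` with `V` time-like, together with linear
isometries `C : 𝕃^(m+1) → V` and `D : ℝ^(n+1) → W`, where `m + n = N` (so that the ranges of `C`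
and `D`, being orthogonal and non-degenerate, span `𝕃^(N+2)` by dimension). -/
structure LorentzSplitting (N m n : ℕ) where
  C : Minkowski m →ₗ[ℝ] Minkowski (N + 1)
  D : EuclideanSpace ℝ (Fin (n + 1)) →ₗ[ℝ] Minkowski (N + 1)
  dim : m + n = N
  lorentz_C : ∀ x y, lorentz (C x) (C y) = lorentz x y
  lorentz_D : ∀ x y, lorentz (D x) (D y) = inner ℝ x y
  lorentz_C_D : ∀ x y, lorentz (C x) (D y) = 0

/-- The map `Θ : (X, Y) ↦ Ψ⁻¹ ((C X + D Y) / ⟨C X + D Y, w⟩)` from `ℍ^m(-c) × 𝕊^n(c)` to `ℝ^N`,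
`N = m + n`, written on the ambient space. -/
def conformalTheta {N m n : ℕ} (T : LightConeTriple N) (S : LorentzSplitting N m n)
    (q : Minkowski m × EuclideanSpace ℝ (Fin (n + 1))) : EuclideanSpace ℝ (Fin N) :=
  T.toEuclidean (S.C q.1 + S.D q.2)

/-- The domain of `Θ` in `ℍ^m(-c) × 𝕊^n(c)`: all points `(X, Y)` with `⟨C X + D Y, w⟩ ≠ 0`, that
is, all points except at most one, which `Θ` sends to infinity. -/
def thetaDomain {N m n : ℕ} (T : LightConeTriple N) (S : LorentzSplitting N m n) (c : ℝ) :
    Set (Minkowski m × EuclideanSpace ℝ (Fin (n + 1))) :=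
  {q | q.1 ∈ hyperbolic m c ∧ q.2 ∈ roundSphere n c ∧ lorentz (S.C q.1 + S.D q.2) T.w ≠ 0}

/-- `Θ` maps the open subset `U` of the Riemannian product `ℍ^m(-c) × 𝕊^n(c)` conformally and
diffeomorphically onto an open subset of `ℝ^N`. Here `Θ` is given on the ambient vector space and
smooth near `U`; the tangent space of `ℍ^m(-c) × 𝕊^n(c)` at `(X, Y)` consists of the `(u, v)` with
`⟨X, u⟩ = 0` and `⟪Y, v⟫ = 0`. The inverse is smooth by the inverse function theorem. -/
structure IsConformalDiffeoOn {N m n : ℕ} (U : Set (Minkowski m × EuclideanSpace ℝ (Fin (n + 1))))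
    (Θ : Minkowski m × EuclideanSpace ℝ (Fin (n + 1)) → EuclideanSpace ℝ (Fin N)) : Prop where
  injOn : Set.InjOn Θ U
  isOpen_image : IsOpen (Θ '' U)
  contDiffAt : ∀ q ∈ U, ContDiffAt ℝ ∞ Θ q
  conformal : ∃ φ : Minkowski m × EuclideanSpace ℝ (Fin (n + 1)) → ℝ, (∀ q ∈ U, 0 < φ q) ∧
    ∀ q ∈ U, ∀ (u u' : Minkowski m) (v v' : EuclideanSpace ℝ (Fin (n + 1))),
      lorentz q.1 u = 0 → lorentz q.1 u' = 0 → inner ℝ q.2 v = 0 → inner ℝ q.2 v' = 0 →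
        inner ℝ (fderiv ℝ Θ q (u, v)) (fderiv ℝ Θ q (u', v'))
          = φ q ^ 2 * (lorentz u u' + inner ℝ v v')

end

/-!
The light cone of `𝕃^(N+2)` carries the conformal geometry of `ℝ^N`: if `φ` is the conformal factor
of `f`, then `F = φ⁻¹ • Ψ(f)` is an isometric immersion of the Riemannian product into the light
cone. A mixed second derivative of `F` is a multiple of the position vector `F`, and it vanishes by
the Gauss equation for the mixed pair and a vector orthogonal to it, which exists because `N ≥ 3`.
Hence `F p = o + ∑ i, G i (p i)` with `o` light-like.

As `F` is light-like, `G i x` and `G j y` are orthogonal for `i ≠ j`, and the tangent spaces of the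
factors give mutually orthogonal subspaces of dimensions `n i`, all orthogonal to `o`. Let `ξ` be
the light-like vector orthogonal to these subspaces with `⟨o, ξ⟩ = 1`. Then orthogonality of `G i x`
and `G j y` reads `⟨G i x, o⟩ ⟨G j y, ξ⟩ + ⟨G i x, ξ⟩ ⟨G j y, o⟩ = 0`. So either every `⟨G i x, ξ⟩`
vanishes, and then `F` takes its values in an affine hyperplane which meets the cone in a copy of
`ℝ^N`, or there are two factors, `⟨G i x, ξ⟩ = -μ ⟨G i x, o⟩` on one and `⟨G j y, ξ⟩ = μ ⟨G j y, o⟩`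
on the other, and then the two components of `F` in an orthogonal decomposition of `𝕃^(N+2)` take
their values in a hyperbolic space and in a sphere.
-/

noncomputable section

/-! ### Charts of manifolds and of finite products of manifolds -/

/-- The derivative of `G` in the constant direction `a`. It is a function of the point, so that it
can be iterated. -/
def dirDeriv {X Y : Type*} [NormedAddCommGroup X] [NormedSpace ℝ X] [NormedAddCommGroup Y]
    [NormedSpace ℝ Y] (a : X) (G : X → Y) (x : X) : Y := fderiv ℝ G x a

/-- The differential at `y` of the inverse of the chart at `x`, which identifies the model vector
space with the tangent space at the point with coordinates `y`. -/
def chartFrame {E H X : Type*} [NormedAddCommGroup E] [NormedSpace ℝ E] [TopologicalSpace H]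
    (I : ModelWithCorners ℝ E H) [TopologicalSpace X] [ChartedSpace H X] (x : X) (y : E) :
    E →L[ℝ] TangentSpace I ((extChartAt I x).symm y) :=
  mfderiv 𝓘(ℝ, E) I (extChartAt I x).symm y

section Chart
variable {E H X Y : Type*} [NormedAddCommGroup E] [NormedSpace ℝ E] [TopologicalSpace H]
  {I : ModelWithCorners ℝ E H} [I.Boundaryless] [TopologicalSpace X] [ChartedSpace H X]
  [IsManifold I ∞ X] [NormedAddCommGroup Y] [NormedSpace ℝ Y] {x : X} {y : E}

theorem mdifferentiableAt_extChartAt_symm_of_mem_target (hy : y ∈ (extChartAt I x).target) :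
    MDifferentiableAt 𝓘(ℝ, E) I (extChartAt I x).symm y :=
  ((contMDiffOn_extChartAt_symm (n := ∞) x).contMDiffAt
    ((isOpen_extChartAt_target x).mem_nhds hy)).mdifferentiableAt (by simp)

theorem bijective_chartFrame (hy : y ∈ (extChartAt I x).target) :
    Function.Bijective (chartFrame I x y) := by
  have : IsManifold I 1 X := IsManifold.of_le (n := ∞) (by simp)
  have h := isInvertible_mfderivWithin_extChartAt_symm (I := I) hy
  rw [ModelWithCorners.range_eq_univ, mfderivWithin_univ] at h
  exact h.bijective

theorem dirDeriv_comp_extChartAt_symm {G : X → Y} (hy : y ∈ (extChartAt I x).target)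
    (hG : MDifferentiableAt I 𝓘(ℝ, Y) G ((extChartAt I x).symm y)) (u : E) :
    dirDeriv u (G ∘ (extChartAt I x).symm) y
      = mvfderiv I G ((extChartAt I x).symm y) (chartFrame I x y u) := by
  have h := mfderiv_comp_apply y hG (mdifferentiableAt_extChartAt_symm_of_mem_target hy) u
  rw [mfderiv_eq_fderiv] at h
  exact h

omit [I.Boundaryless] in
theorem contDiffOn_comp_extChartAt_symm {G : X → Y} (hG : ContMDiff I 𝓘(ℝ, Y) ∞ G)
    (x : X) : ContDiffOn ℝ ∞ (G ∘ (extChartAt I x).symm) (extChartAt I x).target :=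
  (hG.comp_contMDiffOn (contMDiffOn_extChartAt_symm x)).contDiffOn

end Chart

section Pi
variable {ι : Type*} [Fintype ι] {E H M : ι → Type*} [∀ i, NormedAddCommGroup (E i)]
  [∀ i, NormedSpace ℝ (E i)] [∀ i, TopologicalSpace (H i)] [∀ i, TopologicalSpace (M i)]
  [∀ i, ChartedSpace (H i) (M i)]

instance isManifold_pi (I : ∀ i, ModelWithCorners ℝ (E i) (H i)) (m : ℕ∞ω) (M : ι → Type*)
    [∀ i, TopologicalSpace (M i)] [∀ i, ChartedSpace (H i) (M i)] [∀ i, IsManifold (I i) m (M i)] :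
    IsManifold (ModelWithCorners.pi I) m (∀ i, M i) := by
  refine isManifold_of_contDiffOn _ _ _ ?_
  rintro _ _ ⟨e, he, rfl⟩ ⟨e', he', rfl⟩
  rw [contDiffOn_pi]
  intro i
  have h : ContDiffOn ℝ m (I i ∘ ((e i).symm ≫ₕ e' i) ∘ (I i).symm)
      ((I i).symm ⁻¹' ((e i).symm ≫ₕ e' i).source ∩ Set.range (I i)) :=
    (mem_groupoid_of_pregroupoid.1
      (HasGroupoid.compatible (G := contDiffGroupoid m (I i)) (he i trivial) (he' i trivial))).1
  refine h.comp (t := _) (f := fun x : ∀ i, E i => x i)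
    (ContinuousLinearMap.proj (R := ℝ) (φ := E) i).contDiff.contDiffOn ?_
  rintro x ⟨⟨hx, hx'⟩, y, rfl⟩
  exact ⟨⟨hx i trivial, hx' i trivial⟩, y i, rfl⟩

instance boundaryless_modelPi (I : ∀ i, ModelWithCorners ℝ (E i) (H i))
    [∀ i, (I i).Boundaryless] : (ModelWithCorners.pi I).Boundaryless where
  range_eq_univ := (Set.range_piMap _).trans <|
    (Set.pi_congr rfl fun i _ => (I i).range_eq_univ).trans (Set.pi_univ _)

variable {I : ∀ i, ModelWithCorners ℝ (E i) (H i)}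

theorem extChartAt_pi (p : ∀ i, M i) :
    extChartAt (ModelWithCorners.pi I) p = PartialEquiv.pi fun i => extChartAt (I i) (p i) := by
  ext x
  · rfl
  · rfl
  · simp [extChartAt, PartialEquiv.pi, Set.pi, OpenPartialHomeomorph.pi]

theorem mem_extChartAt_pi_target {p : ∀ i, M i} {x : ∀ i, E i} :
    x ∈ (extChartAt (ModelWithCorners.pi I) p).target ↔
      ∀ i, x i ∈ (extChartAt (I i) (p i)).target := by
  rw [extChartAt_pi]
  exact Set.mem_univ_pi

theorem contMDiff_apply_pi {m : ℕ∞ω} (i : ι) :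
    ContMDiff (ModelWithCorners.pi I) (I i) m (fun q : ∀ j, M j => q i) := by
  intro p
  rw [contMDiffAt_iff]
  refine ⟨(continuous_apply i).continuousAt, ?_⟩
  have h : ContDiffWithinAt ℝ m (fun x : ∀ i, E i => x i)
      (Set.range (ModelWithCorners.pi I)) (extChartAt (ModelWithCorners.pi I) p p) :=
    (ContinuousLinearMap.proj (R := ℝ) (φ := E) i).contDiff.contDiffAt.contDiffWithinAt
  refine h.congr_of_eventuallyEq ?_ ?_
  · filter_upwards [extChartAt_target_mem_nhdsWithin (I := ModelWithCorners.pi I) p] with x hx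
    rw [extChartAt_pi]
    exact (extChartAt (I i) (p i)).right_inv (mem_extChartAt_pi_target.1 hx i)
  · rw [extChartAt_pi]
    exact (extChartAt (I i) (p i)).right_inv (mem_extChartAt_target _)

theorem mfderiv_apply_chartFrame [∀ i, (I i).Boundaryless] [∀ i, IsManifold (I i) ∞ (M i)]
    (p : ∀ i, M i) {x : ∀ i, E i}
    (hx : x ∈ (extChartAt (ModelWithCorners.pi I) p).target) (i : ι) (u : ∀ i, E i) :
    mfderiv (ModelWithCorners.pi I) (I i) (fun q : ∀ j, M j => q i)
        ((extChartAt (ModelWithCorners.pi I) p).symm x)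
        (chartFrame (ModelWithCorners.pi I) p x u)
      = chartFrame (I i) (p i) (x i) (u i) := by
  have hproj := (contMDiff_apply_pi (I := I) (M := M) (m := ∞) i).mdifferentiableAt (by simp)
    (x := (extChartAt (ModelWithCorners.pi I) p).symm x)
  have hcomm : (fun q : ∀ j, M j => q i) ∘ (extChartAt (ModelWithCorners.pi I) p).symm =
      (extChartAt (I i) (p i)).symm ∘ ContinuousLinearMap.proj (R := ℝ) (φ := E) i := by
    rw [extChartAt_pi]
    rfl
  refine (mfderiv_comp_apply x hproj
    (mdifferentiableAt_extChartAt_symm_of_mem_target hx) u).symm.trans ?_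
  rw [hcomm]
  refine (mfderiv_comp_apply x (mdifferentiableAt_extChartAt_symm_of_mem_target
    (mem_extChartAt_pi_target.1 hx i)) (ContinuousLinearMap.mdifferentiableAt _) u).trans ?_
  exact congrArg (chartFrame (I i) (p i) (x i))
    (congrArg (fun L : (∀ j, E j) →L[ℝ] E i => L u) (ContinuousLinearMap.mfderiv_eq
      (ContinuousLinearMap.proj (R := ℝ) (φ := E) i)))

end Pi

section RiemMetric
variable {m : ℕ} {X Y : Type*} [TopologicalSpace X] [ChartedSpace (EuclideanSpace ℝ (Fin m)) X]
  [IsManifold (𝓡 m) ∞ X] [NormedAddCommGroup Y] [NormedSpace ℝ Y]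

/-- The metric of a Riemannian manifold in the chart at `p`, as a field of bilinear forms. -/
def chartMetric (g : RiemMetric m X) (p : X) (x : EuclideanSpace ℝ (Fin m)) :
    EuclideanSpace ℝ (Fin m) →L[ℝ] EuclideanSpace ℝ (Fin m) →L[ℝ] ℝ :=
  ContinuousLinearMap.bilinearComp
    (show EuclideanSpace ℝ (Fin m) →L[ℝ] EuclideanSpace ℝ (Fin m) →L[ℝ] ℝ from
      g.inner ((extChartAt (𝓡 m) p).symm x))
    (show EuclideanSpace ℝ (Fin m) →L[ℝ] EuclideanSpace ℝ (Fin m) from chartFrame (𝓡 m) p x)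
    (show EuclideanSpace ℝ (Fin m) →L[ℝ] EuclideanSpace ℝ (Fin m) from chartFrame (𝓡 m) p x)

theorem chartMetric_pos (g : RiemMetric m X) {p : X} {x : EuclideanSpace ℝ (Fin m)}
    (hx : x ∈ (extChartAt (𝓡 m) p).target) {u : EuclideanSpace ℝ (Fin m)} (hu : u ≠ 0) :
    0 < chartMetric g p x u u := by
  refine g.pos _ _ fun h => hu ?_
  exact (bijective_chartFrame hx).1 (h.trans (map_zero _).symm)

theorem isometric_of_extChartAt (g : RiemMetric m X) (B : Y → Y → ℝ) {G : X → Y} {x : X}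
    (hG : MDifferentiableAt (𝓡 m) 𝓘(ℝ, Y) G x)
    (h : ∀ u v, B (dirDeriv u (G ∘ (extChartAt (𝓡 m) x).symm) (extChartAt (𝓡 m) x x))
        (dirDeriv v (G ∘ (extChartAt (𝓡 m) x).symm) (extChartAt (𝓡 m) x x))
      = chartMetric g x (extChartAt (𝓡 m) x x) u v)
    (u v : TangentSpace (𝓡 m) x) :
    B (mvfderiv (𝓡 m) G x u) (mvfderiv (𝓡 m) G x v) = g.inner x u v := by
  have hx := extChartAt_to_inv (I := 𝓡 m) x
  have hframe : ∀ u v : TangentSpace (𝓡 m) ((extChartAt (𝓡 m) x).symm (extChartAt (𝓡 m) x x)),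
      B (mvfderiv (𝓡 m) G _ u) (mvfderiv (𝓡 m) G _ v) = g.inner _ u v := by
    intro u v
    have hsurj := (bijective_chartFrame (mem_extChartAt_target (I := 𝓡 m) x)).2
    obtain ⟨u, rfl⟩ := hsurj u
    obtain ⟨v, rfl⟩ := hsurj v
    have huv := h u v
    rwa [dirDeriv_comp_extChartAt_symm (mem_extChartAt_target x) (by rwa [hx]),
      dirDeriv_comp_extChartAt_symm (mem_extChartAt_target x) (by rwa [hx])] at huv
  rw [hx] at hframe
  exact hframe u v

end RiemMetric

/-! ### Lorentzian linear algebra -/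

theorem exists_orthonormal_frame {V : Type*} [AddCommGroup V] [Module ℝ V] [FiniteDimensional ℝ V]
    {N : ℕ} (hV : Module.finrank ℝ V = N) (B : V →ₗ[ℝ] V →ₗ[ℝ] ℝ) (hs : ∀ x y, B x y = B y x)
    (hp : ∀ x, x ≠ 0 → 0 < B x x) :
    ∃ e : EuclideanSpace ℝ (Fin N) ≃ₗ[ℝ] V, ∀ x y, B (e x) (e y) = inner ℝ x y := by
  let core : InnerProductSpace.Core ℝ V :=
    { inner := fun x y => B x y
      conj_inner_symm := fun x y => by simpa using hs y x
      re_inner_nonneg := fun x => by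
        rcases eq_or_ne x 0 with rfl | h
        · simp
        · simpa using (hp x h).le
      add_left := fun x y z => by simp
      smul_left := fun x y r => by simp
      definite := fun x hx => by
        by_contra h
        exact (hp x h).ne' hx }
  let : NormedAddCommGroup V := core.toNormedAddCommGroup
  let : InnerProductSpace ℝ V := InnerProductSpace.ofCore core.toCore
  let b := (stdOrthonormalBasis ℝ V).reindex (finCongr hV)
  exact ⟨b.repr.symm.toLinearEquiv, fun x y => b.repr.symm.inner_map_map x y⟩

/-- The Lorentz product as a continuous bilinear map. -/
def lorentzL (m : ℕ) : Minkowski m →L[ℝ] Minkowski m →L[ℝ] ℝ :=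
  LinearMap.toContinuousBilinearMap (LinearMap.mk₂ ℝ lorentz lorentz_add_left lorentz_smul_left
    lorentz_add_right lorentz_smul_right)

@[simp] theorem lorentzL_apply {m : ℕ} (x y : Minkowski m) : lorentzL m x y = lorentz x y := rfl

@[simp] theorem lorentz_zero_left {m : ℕ} (y : Minkowski m) : lorentz 0 y = 0 := by
  simp [← lorentzL_apply]

@[simp] theorem lorentz_zero_right {m : ℕ} (y : Minkowski m) : lorentz y 0 = 0 := by
  simp [← lorentzL_apply]

theorem lorentz_sub_left {m : ℕ} (x y z : Minkowski m) :
    lorentz (x - y) z = lorentz x z - lorentz y z := by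
  simp [← lorentzL_apply]

theorem lorentz_sub_right {m : ℕ} (x y z : Minkowski m) :
    lorentz x (y - z) = lorentz x y - lorentz x z := by
  simp [← lorentzL_apply]

theorem lorentz_sum_left {m : ℕ} {ι : Type*} (s : Finset ι) (x : ι → Minkowski m)
    (y : Minkowski m) : lorentz (∑ i ∈ s, x i) y = ∑ i ∈ s, lorentz (x i) y := by
  simp [← lorentzL_apply, map_sum]

theorem lorentz_sum_right {m : ℕ} {ι : Type*} (s : Finset ι) (x : ι → Minkowski m)
    (y : Minkowski m) : lorentz y (∑ i ∈ s, x i) = ∑ i ∈ s, lorentz y (x i) := by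
  simp [← lorentzL_apply, map_sum]

/-- Reversal of the time coordinate, which turns the Lorentz product into the inner product. -/
def timeReversal {m : ℕ} (x : Minkowski m) : Minkowski m :=
  WithLp.toLp 2 (Fin.snoc (fun i : Fin m => x i.castSucc) (-x (Fin.last m)))

theorem lorentz_timeReversal {m : ℕ} (x y : Minkowski m) :
    lorentz (timeReversal x) y = inner ℝ x y := by
  simp [lorentz, timeReversal, PiLp.inner_apply, Fin.sum_univ_castSucc, mul_comm]

/-- The adjoint of `A`: the vector of `ℝ^m` that represents the functional `x ↦ ⟨z, A x⟩`. If `A`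
is a linear isometry, then `A (lorentzAdjoint A z)` is the orthogonal projection of `z` onto the
range of `A`. -/
def lorentzAdjoint {m N : ℕ} (A : EuclideanSpace ℝ (Fin m) →ₗ[ℝ] Minkowski N) :
    Minkowski N →L[ℝ] EuclideanSpace ℝ (Fin m) :=
  LinearMap.toContinuousLinearMap
    { toFun := fun z => WithLp.toLp 2 fun l => lorentz z (A (EuclideanSpace.single l 1))
      map_add' := fun x y => by ext l; simp [lorentz_add_left]
      map_smul' := fun r x => by ext l; simp [lorentz_smul_left] }

theorem inner_lorentzAdjoint {m N : ℕ} (A : EuclideanSpace ℝ (Fin m) →ₗ[ℝ] Minkowski N)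
    (z : Minkowski N) (x : EuclideanSpace ℝ (Fin m)) :
    inner ℝ (lorentzAdjoint A z) x = lorentz z (A x) := by
  conv_rhs => rw [← (EuclideanSpace.basisFun (Fin m) ℝ).sum_repr x]
  simp [map_sum, lorentz_sum_right, lorentz_smul_right, lorentzAdjoint, PiLp.inner_apply]

theorem LightConeTriple.exists_extension {N : ℕ} {o : Minkowski (N + 1)} (ho : o ≠ 0)
    (hoo : lorentz o o = 0) (A : EuclideanSpace ℝ (Fin N) →ₗ[ℝ] Minkowski (N + 1))
    (hA : ∀ x y, lorentz (A x) (A y) = inner ℝ x y) (hAo : ∀ x, lorentz (A x) o = 0) :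
    ∃ T : LightConeTriple N, T.p₀ = o ∧ T.A = A := by
  -- `y` is orthogonal to the range of `A` but not to `o`; it is corrected by a multiple of `o`.
  obtain ⟨y, hyo, hyA⟩ : ∃ y, lorentz y o = ‖o‖ ^ 2 ∧ ∀ x, lorentz y (A x) = 0 := by
    refine ⟨timeReversal o - A (lorentzAdjoint A (timeReversal o)), ?_, fun x => ?_⟩
    · rw [lorentz_sub_left, hAo, lorentz_timeReversal, real_inner_self_eq_norm_sq, sub_zero]
    · rw [lorentz_sub_left, hA, inner_lorentzAdjoint, sub_self]
  set a := (‖o‖ ^ 2)⁻¹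
  set b := a ^ 2 * lorentz y y / 2 with hb
  have ha : a * ‖o‖ ^ 2 = 1 := inv_mul_cancel₀ (by simpa using ho)
  refine ⟨⟨o, a • y - b • o, A, ?_, hoo, ?_, hA, hAo, fun x => ?_⟩, rfl, rfl⟩
  · simp only [lorentz_sub_left, lorentz_sub_right, lorentz_smul_left, lorentz_smul_right, hoo, hyo,
      lorentz_comm o y, hb]
    linear_combination (-(a ^ 2 * lorentz y y)) * ha
  · rw [lorentz_sub_right, lorentz_smul_right, lorentz_smul_right, lorentz_comm, hyo, hoo, ha]
    ring
  · rw [lorentz_sub_right, lorentz_smul_right, lorentz_smul_right, hAo, lorentz_comm, hyA]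
    ring

/-- The triple `p₀ = (0, 1/2, -1/2)`, `w = (0, 1, 1)`, `A x = (x, 0, 0)`. -/
def LightConeTriple.std (N : ℕ) : LightConeTriple N where
  p₀ := WithLp.toLp 2 (Fin.snoc (Fin.snoc (fun _ => 0) (1 / 2)) (-1 / 2))
  w := WithLp.toLp 2 (Fin.snoc (Fin.snoc (fun _ => 0) 1) 1)
  A :=
    { toFun := fun x => WithLp.toLp 2 (Fin.snoc (Fin.snoc (fun i => x i) 0) 0)
      map_add' := fun x y => by
        ext i
        refine Fin.lastCases (by simp) (fun i => Fin.lastCases (by simp) (fun i => by simp) i) i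
      map_smul' := fun r x => by
        ext i
        refine Fin.lastCases (by simp) (fun i => Fin.lastCases (by simp) (fun i => by simp) i) i }
  lorentz_w_w := by simp [lorentz, Fin.sum_univ_castSucc]
  lorentz_p₀_p₀ := by norm_num [lorentz, Fin.sum_univ_castSucc]
  lorentz_p₀_w := by norm_num [lorentz, Fin.sum_univ_castSucc]
  lorentz_A := fun x y => by simp [lorentz, Fin.sum_univ_castSucc, PiLp.inner_apply, mul_comm]
  lorentz_A_p₀ := fun x => by simp [lorentz, Fin.sum_univ_castSucc]
  lorentz_A_w := fun x => by simp [lorentz, Fin.sum_univ_castSucc]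

namespace LightConeTriple
variable {N : ℕ} (T : LightConeTriple N)

theorem lorentz_w_p₀ : lorentz T.w T.p₀ = 1 := by rw [lorentz_comm, T.lorentz_p₀_w]

theorem lorentz_p₀_A (x : EuclideanSpace ℝ (Fin N)) : lorentz T.p₀ (T.A x) = 0 := by
  rw [lorentz_comm, T.lorentz_A_p₀]

theorem lorentz_w_A (x : EuclideanSpace ℝ (Fin N)) : lorentz T.w (T.A x) = 0 := by
  rw [lorentz_comm, T.lorentz_A_w]

theorem lorentz_embed_w (x : EuclideanSpace ℝ (Fin N)) : lorentz (T.embed x) T.w = 1 := by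
  simp [embed, lorentz_sub_left, lorentz_add_left, lorentz_smul_left, T.lorentz_w_w,
    T.lorentz_p₀_w, T.lorentz_A_w]

theorem lorentz_embed_A (x y : EuclideanSpace ℝ (Fin N)) :
    lorentz (T.embed x) (T.A y) = inner ℝ x y := by
  simp [embed, lorentz_sub_left, lorentz_add_left, lorentz_smul_left, T.lorentz_w_A,
    T.lorentz_p₀_A, T.lorentz_A]

theorem lorentz_embed_embed (x y : EuclideanSpace ℝ (Fin N)) :
    lorentz (T.embed x) (T.embed y) = -(1 / 2) * ‖x - y‖ ^ 2 := by
  simp only [embed, lorentz_sub_left, lorentz_add_left, lorentz_smul_left, T.lorentz_w_A,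
    T.lorentz_p₀_A, T.lorentz_A, lorentz_sub_right, lorentz_add_right, lorentz_smul_right,
    T.lorentz_w_w, T.lorentz_p₀_p₀, T.lorentz_p₀_w, T.lorentz_w_p₀, T.lorentz_A_w, T.lorentz_A_p₀,
    norm_sub_sq_real]
  ring

theorem lorentz_embed_self (x : EuclideanSpace ℝ (Fin N)) :
    lorentz (T.embed x) (T.embed x) = 0 := by
  simp [lorentz_embed_embed]

theorem toEuclidean_smul_embed {r : ℝ} (hr : r ≠ 0) (x : EuclideanSpace ℝ (Fin N)) :
    T.toEuclidean (r • T.embed x) = x := by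
  ext j
  simp [toEuclidean, lorentz_smul_left, lorentz_embed_w, lorentz_embed_A, hr,
    EuclideanSpace.inner_single_right]

theorem eq_smul_of_orthogonal {z : Minkowski (N + 1)} (hz : lorentz z T.p₀ = 0)
    (hA : ∀ x, lorentz z (T.A x) = 0) : z = lorentz z T.w • T.p₀ := by
  obtain ⟨a, b, x, rfl⟩ := T.exists_decomp z
  have hb : b = 0 := by
    simpa [lorentz_add_left, lorentz_smul_left, T.lorentz_p₀_p₀, T.lorentz_w_p₀, T.lorentz_A_p₀]
      using hz
  have hx : x = 0 := by
    simpa [lorentz_add_left, lorentz_smul_left, T.lorentz_p₀_A, T.lorentz_w_A, T.lorentz_A]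
      using hA x
  simp [hb, hx, lorentz_smul_left, T.lorentz_p₀_w]

end LightConeTriple

/-! ### Directional derivatives -/

section dirDeriv
variable {X Y : Type*} [NormedAddCommGroup X] [NormedSpace ℝ X] [NormedAddCommGroup Y]
  [NormedSpace ℝ Y] {U : Set X} {x : X} {G : X → Y}

theorem contDiffOn_dirDeriv (hG : ContDiffOn ℝ ∞ G U) (hU : IsOpen U) (a : X) :
    ContDiffOn ℝ ∞ (dirDeriv a G) U :=
  (hG.fderiv_of_isOpen hU (m := ∞) (by simp)).clm_apply contDiffOn_const

theorem differentiableAt_of_contDiffOn (hG : ContDiffOn ℝ ∞ G U) (hU : IsOpen U) (hx : x ∈ U) :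
    DifferentiableAt ℝ G x :=
  (hG.contDiffAt (hU.mem_nhds hx)).differentiableAt (by simp)

theorem differentiableAt_dirDeriv (hG : ContDiffOn ℝ ∞ G U) (hU : IsOpen U) (hx : x ∈ U) (a : X) :
    DifferentiableAt ℝ (dirDeriv a G) x :=
  differentiableAt_of_contDiffOn (contDiffOn_dirDeriv hG hU a) hU hx

theorem dirDeriv_dirDeriv_eq_fderiv_fderiv (hG : ContDiffOn ℝ ∞ G U) (hU : IsOpen U) (hx : x ∈ U)
    (a b : X) : dirDeriv a (dirDeriv b G) x = fderiv ℝ (fderiv ℝ G) x a b := by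
  have h : DifferentiableAt ℝ (fderiv ℝ G) x :=
    differentiableAt_of_contDiffOn (hG.fderiv_of_isOpen hU (m := ∞) (by simp)) hU hx
  unfold dirDeriv
  rw [fderiv_clm_apply h (differentiableAt_const b)]
  simp

theorem dirDeriv_comm (hG : ContDiffOn ℝ ∞ G U) (hU : IsOpen U) (hx : x ∈ U) (a b : X) :
    dirDeriv a (dirDeriv b G) x = dirDeriv b (dirDeriv a G) x := by
  rw [dirDeriv_dirDeriv_eq_fderiv_fderiv hG hU hx, dirDeriv_dirDeriv_eq_fderiv_fderiv hG hU hx]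
  exact ((hG.contDiffAt (hU.mem_nhds hx)).isSymmSndFDerivAt
    (by simp only [minSmoothness_of_isRCLikeNormedField]; exact ENat.LEInfty.out)).eq a b

theorem dirDeriv_congr {G' : X → Y} (hU : IsOpen U) (hx : x ∈ U) (h : ∀ y ∈ U, G y = G' y)
    (a : X) : dirDeriv a G x = dirDeriv a G' x := by
  unfold dirDeriv
  rw [Filter.EventuallyEq.fderiv_eq (Filter.eventually_of_mem (hU.mem_nhds hx) h)]

theorem dirDeriv_eq_zero_of_eqOn_const (hU : IsOpen U) (hx : x ∈ U) {c : Y} (h : ∀ y ∈ U, G y = c)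
    (a : X) : dirDeriv a G x = 0 := by
  rw [dirDeriv_congr hU hx h]
  simp [dirDeriv]

theorem dirDeriv_eq_zero_of_eventually_line (hG : DifferentiableAt ℝ G x) (a : X)
    (h : ∀ᶠ t in nhds (0 : ℝ), G (x + t • a) = G x) : dirDeriv a G x = 0 := by
  have hline : HasDerivAt (fun t : ℝ => G (x + t • a)) (fderiv ℝ G x a) 0 :=
    hG.hasFDerivAt.hasLineDerivAt a
  exact hline.unique ((hasDerivAt_const (0 : ℝ) (G x)).congr_of_eventuallyEq h)

theorem dirDeriv_lorentz {m : ℕ} {G H : X → Minkowski m} (hG : DifferentiableAt ℝ G x)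
    (hH : DifferentiableAt ℝ H x) (a : X) :
    dirDeriv a (fun y => lorentz (G y) (H y)) x
      = lorentz (dirDeriv a G x) (H x) + lorentz (G x) (dirDeriv a H x) := by
  have h := ((lorentzL m).hasFDerivAt.comp x hG.hasFDerivAt).clm_apply hH.hasFDerivAt
  change fderiv ℝ (fun y => (lorentzL m ∘ G) y (H y)) x a = _
  rw [h.fderiv]
  simp [dirDeriv, add_comm]

theorem contDiffOn_lorentz {m : ℕ} {G H : X → Minkowski m} (hG : ContDiffOn ℝ ∞ G U)
    (hH : ContDiffOn ℝ ∞ H U) : ContDiffOn ℝ ∞ (fun y => lorentz (G y) (H y)) U :=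
  ((lorentzL m).contDiff.comp_contDiffOn hG).clm_apply hH

theorem dirDeriv_smul {r : X → ℝ} (hr : DifferentiableAt ℝ r x) (hG : DifferentiableAt ℝ G x)
    (a : X) : dirDeriv a (fun y => r y • G y) x = dirDeriv a r x • G x + r x • dirDeriv a G x := by
  unfold dirDeriv
  rw [fderiv_fun_smul hr hG]
  simp [add_comm]

theorem eq_of_dirDeriv_eq_zero {a : X}
    (hG : ∀ t ∈ Set.Icc (0 : ℝ) 1, DifferentiableAt ℝ G (x + t • a))
    (h : ∀ t ∈ Set.Icc (0 : ℝ) 1, dirDeriv a G (x + t • a) = 0) : G (x + a) = G x := by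
  have hderiv : ∀ t ∈ Set.Icc (0 : ℝ) 1,
      HasDerivWithinAt (fun s : ℝ => G (x + s • a)) 0 (Set.Icc 0 1) t := by
    intro t ht
    have hline : HasDerivAt (fun s : ℝ => x + s • a) a t := by
      simpa using ((hasDerivAt_id t).smul_const a).const_add x
    exact h t ht ▸ ((hG t ht).hasFDerivAt.comp_hasDerivAt t hline).hasDerivWithinAt
  have hle := (convex_Icc (0 : ℝ) 1).norm_image_sub_le_of_norm_hasDerivWithin_le (C := 0)
    (x := 0) (y := 1) hderiv (by simp) (by simp) (by simp)
  simpa [sub_eq_zero] using hle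

end dirDeriv

/-! ### Isometric immersions of products into the light cone -/

section Product
variable {ι : Type*} [Fintype ι] {E : ι → Type*} [∀ i, NormedAddCommGroup (E i)]
  [∀ i, NormedSpace ℝ (E i)]

/-- `F` is, on the open set `U`, an isometric immersion into the light cone of the Riemannian
product with metric `∑ i, h i`, where `h i` is a metric on a part of the vector space `E i`. -/
structure IsLightConeImmersion {N : ℕ} (h : ∀ i, E i → E i →L[ℝ] E i →L[ℝ] ℝ) (U : Set (∀ i, E i))
    (F : (∀ i, E i) → Minkowski (N + 1)) : Prop where
  isOpen : IsOpen U
  contDiffOn : ContDiffOn ℝ ∞ F U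
  null : ∀ x ∈ U, lorentz (F x) (F x) = 0
  ne_zero : ∀ x ∈ U, F x ≠ 0
  pos : ∀ x ∈ U, ∀ i v, v ≠ 0 → 0 < h i (x i) v v
  isometric : ∀ x ∈ U, ∀ u v,
    lorentz (dirDeriv u F x) (dirDeriv v F x) = ∑ i, h i (x i) (u i) (v i)

-- The Koszul formula: of the three terms that express `⟨∇_a b, z⟩`, two are derivatives along `a`
-- and `b` of functions which only depend on the other coordinates, and one is a derivative of zero.
theorem lorentz_dirDeriv_dirDeriv_eq_zero_of_product {m : ℕ}
    {h : ∀ i, E i → E i →L[ℝ] E i →L[ℝ] ℝ} {U : Set (∀ i, E i)} {F : (∀ i, E i) → Minkowski m}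
    (hU : IsOpen U) (hF : ContDiffOn ℝ ∞ F U)
    (hiso : ∀ x ∈ U, ∀ u v, lorentz (dirDeriv u F x) (dirDeriv v F x) = ∑ i, h i (x i) (u i) (v i))
    {a b : ∀ i, E i} (hab : ∀ i, a i = 0 ∨ b i = 0) (z : ∀ i, E i) {x : ∀ i, E i} (hx : x ∈ U) :
    lorentz (dirDeriv a (dirDeriv b F) x) (dirDeriv z F x) = 0 := by
  have hd := differentiableAt_dirDeriv hF hU hx
  have hline : ∀ {a b : ∀ i, E i}, (∀ i, a i = 0 ∨ b i = 0) →
      lorentz (dirDeriv a (dirDeriv b F) x) (dirDeriv z F x)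
        + lorentz (dirDeriv b F x) (dirDeriv a (dirDeriv z F) x) = 0 := by
    intro a b hab
    rw [← dirDeriv_lorentz (hd _) (hd _)]
    refine dirDeriv_eq_zero_of_eventually_line (differentiableAt_of_contDiffOn
      (contDiffOn_lorentz (contDiffOn_dirDeriv hF hU _) (contDiffOn_dirDeriv hF hU _)) hU hx) _ ?_
    have hcont : Continuous fun t : ℝ => x + t • a := by fun_prop
    have hnear := hcont.continuousAt.preimage_mem_nhds (x := 0) (hU.mem_nhds (by simpa using hx))
    filter_upwards [hnear] with t ht
    rw [hiso _ ht, hiso x hx]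
    refine Finset.sum_congr rfl fun i _ => ?_
    rcases hab i with hi | hi <;> simp [hi]
  have hzero : lorentz (dirDeriv z (dirDeriv a F) x) (dirDeriv b F x)
      + lorentz (dirDeriv a F x) (dirDeriv z (dirDeriv b F) x) = 0 := by
    rw [← dirDeriv_lorentz (hd _) (hd _)]
    refine dirDeriv_eq_zero_of_eqOn_const (c := 0) hU hx (fun y hy => ?_) z
    rw [hiso y hy]
    refine Finset.sum_eq_zero fun i _ => ?_
    rcases hab i with hi | hi <;> simp [hi]
  have hab' := hline hab
  have hba := hline fun i => (hab i).symm
  rw [dirDeriv_comm hF hU hx z, dirDeriv_comm hF hU hx z] at hzero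
  rw [dirDeriv_comm hF hU hx b a] at hba
  have hcomm := lorentz_comm (dirDeriv b F x) (dirDeriv a (dirDeriv z F) x)
  linarith

theorem exists_smul_of_orthogonal {V : Type*} [AddCommGroup V] [Module ℝ V]
    [FiniteDimensional ℝ V] {N : ℕ} (hV : Module.finrank ℝ V = N) (D : V →ₗ[ℝ] Minkowski (N + 1))
    {o : Minkowski (N + 1)} (ho : o ≠ 0) (hoo : lorentz o o = 0) (hDo : ∀ u, lorentz (D u) o = 0)
    (hpos : ∀ u, u ≠ 0 → 0 < lorentz (D u) (D u)) {z : Minkowski (N + 1)}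
    (hzo : lorentz z o = 0) (hzD : ∀ u, lorentz z (D u) = 0) : ∃ β : ℝ, z = β • o := by
  obtain ⟨e, he⟩ := exists_orthonormal_frame hV
    ((LinearMap.mk₂ ℝ lorentz lorentz_add_left lorentz_smul_left lorentz_add_right
      lorentz_smul_right).compl₁₂ D D) (fun x y => lorentz_comm _ _) hpos
  obtain ⟨T, rfl, hA⟩ := LightConeTriple.exists_extension ho hoo (D ∘ₗ e.toLinearMap) he
    (fun x => hDo _)
  exact ⟨_, T.eq_smul_of_orthogonal hzo (fun x => by rw [hA]; exact hzD _)⟩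

omit [Fintype ι] in
theorem exists_ne_zero_of_finrank_lt [Finite ι] [∀ i, FiniteDimensional ℝ (E i)]
    (φ : (∀ i, E i) →ₗ[ℝ] ℝ) {j : ι}
    (hj : Module.finrank ℝ (E j) + 1 < Module.finrank ℝ (∀ i, E i)) :
    ∃ c : ∀ i, E i, c ≠ 0 ∧ c j = 0 ∧ φ c = 0 := by
  let L : (∀ i, E i) →ₗ[ℝ] E j × ℝ := (LinearMap.proj j).prod φ
  obtain ⟨c, hc, hc0⟩ := (Submodule.ne_bot_iff _).1
    (LinearMap.ker_ne_bot_of_finrank_lt (f := L) (by simpa using hj))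
  obtain ⟨hcj, hφ⟩ := Prod.mk_eq_zero.1 (LinearMap.mem_ker.1 hc)
  exact ⟨c, hc0, hcj, hφ⟩

namespace IsLightConeImmersion
variable {N : ℕ} {h : ∀ i, E i → E i →L[ℝ] E i →L[ℝ] ℝ} {U : Set (∀ i, E i)}
  {F : (∀ i, E i) → Minkowski (N + 1)} (hF : IsLightConeImmersion h U F) {x : ∀ i, E i}
  {a b c : ∀ i, E i}
include hF

theorem lorentz_dirDeriv_self (hx : x ∈ U) (a : ∀ i, E i) :
    lorentz (dirDeriv a F x) (F x) = 0 := by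
  have hd := differentiableAt_of_contDiffOn hF.contDiffOn hF.isOpen hx
  have hsum := dirDeriv_lorentz hd hd a
  rw [dirDeriv_eq_zero_of_eqOn_const hF.isOpen hx hF.null, lorentz_comm (F x)] at hsum
  linarith

theorem lorentz_dirDeriv_dirDeriv_self (hx : x ∈ U) (a b : ∀ i, E i) :
    lorentz (dirDeriv a (dirDeriv b F) x) (F x) = -lorentz (dirDeriv b F x) (dirDeriv a F x) := by
  have hsum := dirDeriv_lorentz (differentiableAt_dirDeriv hF.contDiffOn hF.isOpen hx b)
    (differentiableAt_of_contDiffOn hF.contDiffOn hF.isOpen hx) a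
  rw [dirDeriv_eq_zero_of_eqOn_const hF.isOpen hx fun y hy => hF.lorentz_dirDeriv_self hy b] at hsum
  linarith

theorem lorentz_dirDeriv_pos (hx : x ∈ U) (ha : a ≠ 0) :
    0 < lorentz (dirDeriv a F x) (dirDeriv a F x) := by
  rw [hF.isometric x hx]
  obtain ⟨l, hl⟩ := Function.ne_iff.1 ha
  refine Finset.sum_pos' (fun m _ => ?_) ⟨l, Finset.mem_univ l, hF.pos x hx l _ hl⟩
  rcases eq_or_ne (a m) 0 with h0 | h0
  · simp [h0]
  · exact (hF.pos x hx m _ h0).le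

theorem lorentz_dirDeriv_dirDeriv (hx : x ∈ U) (hab : ∀ i, a i = 0 ∨ b i = 0) (z : ∀ i, E i) :
    lorentz (dirDeriv a (dirDeriv b F) x) (dirDeriv z F x) = 0 :=
  lorentz_dirDeriv_dirDeriv_eq_zero_of_product hF.isOpen hF.contDiffOn hF.isometric hab z hx

theorem exists_dirDeriv_dirDeriv_eq_smul [∀ i, FiniteDimensional ℝ (E i)]
    (hN : Module.finrank ℝ (∀ i, E i) = N) (hx : x ∈ U) (hab : ∀ i, a i = 0 ∨ b i = 0) :
    ∃ β : ℝ, dirDeriv a (dirDeriv b F) x = β • F x := by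
  refine exists_smul_of_orthogonal hN (fderiv ℝ F x).toLinearMap (hF.ne_zero x hx) (hF.null x hx)
    (hF.lorentz_dirDeriv_self hx) (fun u hu => hF.lorentz_dirDeriv_pos hx hu) ?_
    (hF.lorentz_dirDeriv_dirDeriv hx hab)
  rw [hF.lorentz_dirDeriv_dirDeriv_self hx, hF.isometric x hx, neg_eq_zero]
  refine Finset.sum_eq_zero fun i _ => ?_
  rcases hab i with hi | hi <;> simp [hi]

-- The Gauss equation: the curvature of a product vanishes on a mixed pair of tangent vectors.
theorem lorentz_dirDeriv_dirDeriv_comm (hx : x ∈ U) (hab : ∀ i, a i = 0 ∨ b i = 0)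
    (hcb : ∀ i, c i = 0 ∨ b i = 0) :
    lorentz (dirDeriv a (dirDeriv b F) x) (dirDeriv c (dirDeriv c F) x)
      = lorentz (dirDeriv c (dirDeriv b F) x) (dirDeriv a (dirDeriv c F) x) := by
  have hd := fun a => differentiableAt_dirDeriv hF.contDiffOn hF.isOpen hx a
  have hdd := fun a b => differentiableAt_dirDeriv (contDiffOn_dirDeriv hF.contDiffOn hF.isOpen b)
    hF.isOpen hx a
  have hc := dirDeriv_lorentz (hdd a b) (hd c) c
  have ha := dirDeriv_lorentz (hdd c b) (hd c) a
  rw [dirDeriv_eq_zero_of_eqOn_const hF.isOpen hx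
    fun y hy => hF.lorentz_dirDeriv_dirDeriv hy hab c] at hc
  rw [dirDeriv_eq_zero_of_eqOn_const hF.isOpen hx
    fun y hy => hF.lorentz_dirDeriv_dirDeriv hy hcb c,
    dirDeriv_comm (contDiffOn_dirDeriv hF.contDiffOn hF.isOpen b) hF.isOpen hx a c] at ha
  linarith

theorem dirDeriv_dirDeriv_eq_zero_of_orthogonal [∀ i, FiniteDimensional ℝ (E i)]
    (hN : Module.finrank ℝ (∀ i, E i) = N) (hx : x ∈ U) (hab : ∀ i, a i = 0 ∨ b i = 0)
    (hcb : ∀ i, c i = 0 ∨ b i = 0) (hc : c ≠ 0)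
    (hac : lorentz (dirDeriv a F x) (dirDeriv c F x) = 0) :
    dirDeriv a (dirDeriv b F) x = 0 := by
  obtain ⟨β, hβ⟩ := hF.exists_dirDeriv_dirDeriv_eq_smul hN hx hab
  obtain ⟨γ, hγ⟩ := hF.exists_dirDeriv_dirDeriv_eq_smul hN hx hcb
  have hgauss := hF.lorentz_dirDeriv_dirDeriv_comm hx hab hcb
  rw [hβ, hγ, lorentz_smul_left, lorentz_smul_left, lorentz_comm (F x), lorentz_comm (F x),
    hF.lorentz_dirDeriv_dirDeriv_self hx, hF.lorentz_dirDeriv_dirDeriv_self hx,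
    lorentz_comm (dirDeriv c F x) (dirDeriv a F x), hac] at hgauss
  have hβ0 : β = 0 := by simpa [(hF.lorentz_dirDeriv_pos hx hc).ne'] using hgauss
  rw [hβ, hβ0, zero_smul]

theorem dirDeriv_single_dirDeriv_single_eq_zero [DecidableEq ι] [∀ i, FiniteDimensional ℝ (E i)]
    (hN : Module.finrank ℝ (∀ i, E i) = N) (hN3 : 3 ≤ N) {i j : ι} (hij : i ≠ j) (u : E i)
    (v : E j) (hx : x ∈ U) : dirDeriv (Pi.single i u) (dirDeriv (Pi.single j v) F) x = 0 := by
  have hdisj : ∀ {j : ι} (c : ∀ l, E l), c j = 0 → ∀ (v : E j) (l : ι),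
      c l = 0 ∨ (Pi.single j v : ∀ l, E l) l = 0 := by
    intro j c hc v l
    rcases eq_or_ne l j with rfl | hl
    · exact Or.inl hc
    · exact Or.inr (Pi.single_eq_of_ne hl v)
  let ψ (a : ∀ l, E l) : (∀ l, E l) →ₗ[ℝ] ℝ :=
    ((lorentzL _ (dirDeriv a F x)).comp (fderiv ℝ F x)).toLinearMap
  have hsum : Module.finrank ℝ (E i) + Module.finrank ℝ (E j) ≤ N := by
    rw [← hN, Module.finrank_pi_fintype]
    exact Finset.add_le_sum (f := fun l => Module.finrank ℝ (E l)) (fun _ _ => Nat.zero_le _)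
      (Finset.mem_univ i) (Finset.mem_univ j) hij
  rcases (by omega : Module.finrank ℝ (E j) + 1 < N ∨ Module.finrank ℝ (E i) + 1 < N) with hj | hi
  · obtain ⟨c, hc, hcj, hac⟩ := exists_ne_zero_of_finrank_lt (ψ (Pi.single i u)) (hN ▸ hj)
    exact hF.dirDeriv_dirDeriv_eq_zero_of_orthogonal hN hx
      (hdisj _ (Pi.single_eq_of_ne hij.symm u) v) (hdisj c hcj v) hc hac
  · obtain ⟨c, hc, hci, hbc⟩ := exists_ne_zero_of_finrank_lt (ψ (Pi.single j v)) (hN ▸ hi)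
    rw [dirDeriv_comm hF.contDiffOn hF.isOpen hx]
    exact hF.dirDeriv_dirDeriv_eq_zero_of_orthogonal hN hx
      (hdisj _ (Pi.single_eq_of_ne hij v) u) (hdisj c hci u) hc hbc

end IsLightConeImmersion
end Product

/-! ### Vanishing mixed differences -/

section MixedDifference
variable {ι : Type*} [DecidableEq ι] {M : ι → Type*} {Y : Type*} [AddCommGroup Y]

/-- On the box with sides `W i`, all second differences of `F` with respect to two distinct
coordinates vanish. On a full product this says that `F` is a sum of functions of one
coordinate. -/
def HasZeroMixedDifferencesOn (F : (∀ i, M i) → Y) (W : ∀ i, Set (M i)) : Prop :=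
  ∀ i j, i ≠ j → ∀ q, (∀ l, q l ∈ W l) → ∀ y ∈ W i, ∀ t ∈ W j,
    F (Function.update (Function.update q i y) j t) + F q
      = F (Function.update q i y) + F (Function.update q j t)

theorem HasZeroMixedDifferencesOn.eq_add_sum [Fintype ι] {F : (∀ i, M i) → Y}
    (hF : HasZeroMixedDifferencesOn F fun _ => Set.univ) (o p : ∀ i, M i) :
    F p = F o + ∑ i, (F (Function.update o i (p i)) - F o) := by
  have hstep : ∀ s : Finset ι, ∀ i ∉ s, ∀ y, F (Function.update (s.piecewise p o) i y)
      - F (s.piecewise p o) = F (Function.update o i y) - F o := by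
    intro s
    induction s using Finset.induction_on with
    | empty => simp
    | insert j s _ ih =>
      intro i hi y
      obtain ⟨hij, his⟩ := not_or.1 (Finset.mem_insert.not.1 hi)
      rw [← ih i his y, Finset.piecewise_insert, sub_eq_sub_iff_add_eq_add,
        Function.update_comm (Ne.symm hij)]
      exact hF i j hij _ (fun _ => trivial) y trivial (p j) trivial
  have hsum : ∀ s : Finset ι,
      F (s.piecewise p o) = F o + ∑ i ∈ s, (F (Function.update o i (p i)) - F o) := by
    intro s
    induction s using Finset.induction_on with
    | empty => simp
    | insert j s hj ih =>
      rw [Finset.sum_insert hj, ← hstep s j hj, Finset.piecewise_insert, add_left_comm, ← ih,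
        sub_add_cancel]
  simpa using hsum Finset.univ

theorem sub_eq_sub_of_locally {A C : Type*} [TopologicalSpace A] [TopologicalSpace C]
    [PreconnectedSpace A] [PreconnectedSpace C] (H : A → C → Y)
    (hloc : ∀ a c, ∃ U ∈ nhds a, ∃ V ∈ nhds c, ∀ x ∈ U, ∀ y ∈ U, ∀ s ∈ V, ∀ t ∈ V,
      H x s - H x t = H y s - H y t) (x y : A) (s t : C) : H x s - H x t = H y s - H y t := by
  have hnear : ∀ a s t, ∃ U ∈ nhds a, ∀ x ∈ U, ∀ y ∈ U, H x s - H x t = H y s - H y t := by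
    intro a s t
    refine PreconnectedSpace.induction₂'
      (fun s t => ∃ U ∈ nhds a, ∀ x ∈ U, ∀ y ∈ U, H x s - H x t = H y s - H y t) ?_ ?_ s t
    · intro c
      obtain ⟨U, hU, V, hV, h⟩ := hloc a c
      filter_upwards [hV] with d hd
      exact ⟨⟨U, hU, fun x hx y hy => h x hx y hy c (mem_of_mem_nhds hV) d hd⟩,
        ⟨U, hU, fun x hx y hy => h x hx y hy d hd c (mem_of_mem_nhds hV)⟩⟩
    · refine ⟨fun a b c hab hbc => ?_⟩
      obtain ⟨U, hU, h⟩ := hab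
      obtain ⟨V, hV, h'⟩ := hbc
      refine ⟨U ∩ V, Filter.inter_mem hU hV, fun x hx y hy => ?_⟩
      rw [← sub_add_sub_cancel (H x a) (H x b), h x hx.1 y hy.1, h' x hx.2 y hy.2,
        sub_add_sub_cancel]
  refine PreconnectedSpace.induction₂' (fun x y => H x s - H x t = H y s - H y t) ?_ ?_ x y
  · intro a
    obtain ⟨U, hU, h⟩ := hnear a s t
    filter_upwards [hU] with b hb
    exact ⟨h a (mem_of_mem_nhds hU) b hb, h b hb a (mem_of_mem_nhds hU)⟩
  · exact ⟨fun _ _ _ => Eq.trans⟩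

theorem hasZeroMixedDifferencesOn_univ_of_locally [∀ i, TopologicalSpace (M i)]
    [∀ i, PreconnectedSpace (M i)] {F : (∀ i, M i) → Y}
    (h : ∀ p : ∀ i, M i, ∃ W, (∀ i, W i ∈ nhds (p i)) ∧ HasZeroMixedDifferencesOn F W) :
    HasZeroMixedDifferencesOn F fun _ => Set.univ := by
  intro i j hij q _ y _ t _
  have hsub := sub_eq_sub_of_locally
    (fun y t => F (Function.update (Function.update q i y) j t)) ?_ y (q i) t (q j)
  · simp only [Function.update_eq_self] at hsub
    rw [Function.update_comm hij y (q j), Function.update_eq_self, sub_eq_sub_iff_add_eq_add]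
      at hsub
    exact hsub.trans (add_comm _ _)
  intro a c
  obtain ⟨W, hW, hF⟩ := h (Function.update (Function.update q i a) j c)
  refine ⟨W i, by simpa [hij] using hW i, W j, by simpa using hW j, fun x hx y hy s hs t ht => ?_⟩
  have hmem : ∀ l, Function.update (Function.update q i x) j s l ∈ W l := by
    intro l
    rcases eq_or_ne l j with rfl | hlj
    · simpa using hs
    rcases eq_or_ne l i with rfl | hli
    · simpa [hlj] using hx
    · simpa [hlj, hli] using mem_of_mem_nhds (hW l)
  have hxy := hF i j hij _ hmem y hy t ht
  rw [Function.update_comm hij.symm s y, Function.update_idem, Function.update_idem,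
    Function.update_idem] at hxy
  rw [sub_eq_sub_iff_add_eq_add]
  exact (add_comm _ _).trans hxy

end MixedDifference

theorem add_eq_add_of_dirDeriv_dirDeriv_eq_zero {X Y : Type*} [NormedAddCommGroup X]
    [NormedSpace ℝ X] [NormedAddCommGroup Y] [NormedSpace ℝ Y] {U : Set X} {F : X → Y} {a b x : X}
    (hU : IsOpen U) (hF : ContDiffOn ℝ ∞ F U) (h : ∀ y ∈ U, dirDeriv a (dirDeriv b F) y = 0)
    (hx : ∀ r ∈ Set.Icc (0 : ℝ) 1, ∀ s ∈ Set.Icc (0 : ℝ) 1, x + s • b + r • a ∈ U) :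
    F (x + b + a) + F x = F (x + a) + F (x + b) := by
  have hx₀ : ∀ s ∈ Set.Icc (0 : ℝ) 1, x + s • b ∈ U := fun s hs => by
    simpa using hx 0 (by simp) s hs
  have hx₁ : ∀ s ∈ Set.Icc (0 : ℝ) 1, x + s • b + a ∈ U := fun s hs => by
    simpa using hx 1 (by simp) s hs
  have hb : ∀ s ∈ Set.Icc (0 : ℝ) 1, dirDeriv b F (x + s • b + a) = dirDeriv b F (x + s • b) :=
    fun s hs => eq_of_dirDeriv_eq_zero
      (fun r hr => differentiableAt_dirDeriv hF hU (hx r hr s hs) b) fun r hr => h _ (hx r hr s hs)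
  have hdiff : ∀ s ∈ Set.Icc (0 : ℝ) 1, HasFDerivAt (fun y => F (y + a) - F y)
      (fderiv ℝ F (x + s • b + a) - fderiv ℝ F (x + s • b)) (x + s • b) := fun s hs =>
    ((hasFDerivAt_comp_add_right a).2
      (differentiableAt_of_contDiffOn hF hU (hx₁ s hs)).hasFDerivAt).sub
      (differentiableAt_of_contDiffOn hF hU (hx₀ s hs)).hasFDerivAt
  have hend : F (x + b + a) - F (x + b) = F (x + a) - F x := by
    refine eq_of_dirDeriv_eq_zero (G := fun y => F (y + a) - F y)
      (fun s hs => (hdiff s hs).differentiableAt) fun s hs => ?_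
    rw [dirDeriv, (hdiff s hs).fderiv]
    exact sub_eq_zero.2 (hb s hs)
  exact sub_eq_sub_iff_add_eq_add.1 hend

section Product
variable {ι : Type*} [Fintype ι] [DecidableEq ι] {E : ι → Type*} [∀ i, NormedAddCommGroup (E i)]
  [∀ i, NormedSpace ℝ (E i)] {B : ∀ i, Set (E i)}

theorem hasZeroMixedDifferencesOn_of_dirDeriv_dirDeriv_eq_zero {Y : Type*} [NormedAddCommGroup Y]
    [NormedSpace ℝ Y] {F : (∀ i, E i) → Y} (hB : IsOpen (Set.univ.pi B))
    (hBc : ∀ i, Convex ℝ (B i)) (hF : ContDiffOn ℝ ∞ F (Set.univ.pi B))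
    (h : ∀ i j, i ≠ j → ∀ u v, ∀ x ∈ Set.univ.pi B,
      dirDeriv (Pi.single i u) (dirDeriv (Pi.single j v) F) x = 0) :
    HasZeroMixedDifferencesOn F B := by
  intro i j hij q hq y hy t ht
  have hupdate : ∀ (q : ∀ i, E i) i y, Function.update q i y = q + Pi.single i (y - q i) := by
    intro q i y
    ext1 l
    rcases eq_or_ne l i with rfl | hl
    · simp
    · simp [hl]
  have hbox : ∀ {q : ∀ i, E i}, (∀ l, q l ∈ B l) → ∀ {i y}, y ∈ B i → ∀ r ∈ Set.Icc (0 : ℝ) 1,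
      ∀ l, (q + r • Pi.single i (y - q i)) l ∈ B l := by
    intro q hq i y hy r hr l
    rcases eq_or_ne l i with rfl | hl
    · simpa using (hBc l).add_smul_sub_mem (hq l) hy hr
    · simpa [hl] using hq l
  have hsum := add_eq_add_of_dirDeriv_dirDeriv_eq_zero (a := Pi.single i (y - q i))
    (b := Pi.single j (t - q j)) (x := q) hB hF (h i j hij _ _) fun r hr s hs l _ => by
      have hmem := hbox (hbox hq ht s hs) hy r hr l
      simpa [hij] using hmem
  rw [hupdate (Function.update q i y), Function.update_of_ne hij.symm, hupdate, hupdate,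
    add_right_comm]
  exact hsum

/-! ### Conformal immersions of products -/

/-- `f` is, on the open set `U`, a conformal immersion with conformal factor `φ` of the Riemannian
product with metric `∑ i, h i`, where `h i` is a metric on a part of the vector space `E i`. -/
structure IsConformalImmersionOn {Y : Type*} [NormedAddCommGroup Y] [InnerProductSpace ℝ Y]
    (h : ∀ i, E i → E i →L[ℝ] E i →L[ℝ] ℝ) (φ : (∀ i, E i) → ℝ) (U : Set (∀ i, E i))
    (f : (∀ i, E i) → Y) : Prop where
  isOpen : IsOpen U
  contDiffOn : ContDiffOn ℝ ∞ f U
  factor_pos : ∀ x ∈ U, 0 < φ x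
  pos : ∀ x ∈ U, ∀ i v, v ≠ 0 → 0 < h i (x i) v v
  conformal : ∀ x ∈ U, ∀ u v,
    inner ℝ (dirDeriv u f x) (dirDeriv v f x) = φ x ^ 2 * ∑ i, h i (x i) (u i) (v i)

namespace IsConformalImmersionOn
variable {h : ∀ i, E i → E i →L[ℝ] E i →L[ℝ] ℝ} {φ : (∀ i, E i) → ℝ}
  {Y : Type*} [NormedAddCommGroup Y] [InnerProductSpace ℝ Y] {f : (∀ i, E i) → Y}

theorem inner_dirDeriv_single {U : Set (∀ i, E i)} (hf : IsConformalImmersionOn h φ U f)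
    {x : ∀ i, E i} (hx : x ∈ U) (i : ι) (u : E i) :
    inner ℝ (dirDeriv (Pi.single i u) f x) (dirDeriv (Pi.single i u) f x)
      = φ x ^ 2 * h i (x i) u u := by
  rw [hf.conformal x hx, Finset.sum_eq_single i]
  · simp
  · intro l _ hl
    simp [Pi.single_eq_of_ne hl]
  · simp

-- The metrics `h i` need not be smooth, but if `y` agrees with `x` in the `i`-th and with `c` in
-- the `j`-th coordinate, then their values cancel in this quotient, up to a constant.
theorem sq_factor_eq {U : Set (∀ i, E i)} (hf : IsConformalImmersionOn h φ U f)
    {x y c : ∀ i, E i} (hx : x ∈ U) (hy : y ∈ U) (hc : c ∈ U) {i j : ι} (hi : y i = x i)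
    (hj : y j = c j) {u : E i} (hu : u ≠ 0) {v : E j} (hv : v ≠ 0) :
    φ x ^ 2 = inner ℝ (dirDeriv (Pi.single i u) f x) (dirDeriv (Pi.single i u) f x)
      * inner ℝ (dirDeriv (Pi.single j v) f y) (dirDeriv (Pi.single j v) f y)
      / (inner ℝ (dirDeriv (Pi.single i u) f y) (dirDeriv (Pi.single i u) f y)
        * h j (c j) v v) := by
  rw [hf.inner_dirDeriv_single hx, hf.inner_dirDeriv_single hy, hf.inner_dirDeriv_single hy, hi, hj]
  have hφ := (hf.factor_pos y hy).ne'
  have hiu := (hf.pos x hx i u hu).ne'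
  have hjv := (hf.pos c hc j v hv).ne'
  field_simp

omit [DecidableEq ι] in
theorem contDiffOn_factor (hf : IsConformalImmersionOn h φ (Set.univ.pi B) f) {i j : ι}
    [Nontrivial (E i)] [Nontrivial (E j)] (hij : i ≠ j) :
    ContDiffOn ℝ ∞ φ (Set.univ.pi B) := by
  classical
  rcases (Set.univ.pi B).eq_empty_or_nonempty with hempty | ⟨c, hc⟩
  · rw [hempty]
    exact contDiffOn_empty
  obtain ⟨u, hu⟩ := exists_ne (0 : E i)
  obtain ⟨v, hv⟩ := exists_ne (0 : E j)
  let S (l : ι) (a : E l) (x : ∀ i, E i) : ℝ :=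
    inner ℝ (dirDeriv (Pi.single l a) f x) (dirDeriv (Pi.single l a) f x)
  let y (x : ∀ i, E i) : ∀ i, E i := Function.update c i (x i)
  have hy : Set.MapsTo y (Set.univ.pi B) (Set.univ.pi B) := fun x hx =>
    (Set.update_mem_pi_iff_of_mem hc).2 fun _ => hx i trivial
  have hyc : ContDiff ℝ ∞ y :=
    (contDiff_update ∞ c i).comp (ContinuousLinearMap.proj (R := ℝ) (φ := E) i).contDiff
  have hS : ∀ l a, ContDiffOn ℝ ∞ (S l a) (Set.univ.pi B) := fun l a =>
    (contDiffOn_dirDeriv hf.contDiffOn hf.isOpen _).inner ℝ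
      (contDiffOn_dirDeriv hf.contDiffOn hf.isOpen _)
  have hSy : ∀ l a, ContDiffOn ℝ ∞ (fun x => S l a (y x)) (Set.univ.pi B) := fun l a =>
    (hS l a).comp hyc.contDiffOn hy
  have hSpos : ∀ x ∈ Set.univ.pi B, 0 < S i u x := fun x hx =>
    (mul_pos (pow_pos (hf.factor_pos x hx) 2) (hf.pos x hx i u hu)).trans_eq
      (hf.inner_dirDeriv_single hx i u).symm
  have hsq : ContDiffOn ℝ ∞ (fun x => φ x ^ 2) (Set.univ.pi B) :=
    (((hS i u).mul (hSy j v)).div ((hSy i u).mul contDiffOn_const) fun x hx =>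
      mul_ne_zero (hSpos _ (hy hx)).ne' (hf.pos c hc j v hv).ne').congr fun x hx =>
        hf.sq_factor_eq hx (hy hx) hc (Function.update_self ..)
          (Function.update_of_ne hij.symm ..) hu hv
  exact (hsq.sqrt fun x hx => (pow_pos (hf.factor_pos x hx) 2).ne').congr fun x hx =>
    (Real.sqrt_sq (hf.factor_pos x hx).le).symm

end IsConformalImmersionOn
end Product

/-! ### The lift to the light cone -/

section lift
variable {N : ℕ} (T : LightConeTriple N) {X : Type*}

/-- The lift `φ⁻¹ • Ψ(f)` to the light cone of a map `f` into `ℝ^N`. It is isometric if `f` is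
conformal with conformal factor `φ`. -/
def lightConeLift (φ : X → ℝ) (f : X → EuclideanSpace ℝ (Fin N)) (x : X) : Minkowski (N + 1) :=
  (φ x)⁻¹ • T.embed (f x)

theorem lorentz_lightConeLift_self (φ : X → ℝ) (f : X → EuclideanSpace ℝ (Fin N)) (x : X) :
    lorentz (lightConeLift T φ f x) (lightConeLift T φ f x) = 0 := by
  simp [lightConeLift, lorentz_smul_left, lorentz_smul_right, T.lorentz_embed_self]

theorem lightConeLift_ne_zero {φ : X → ℝ} {x : X} (hφ : φ x ≠ 0)
    (f : X → EuclideanSpace ℝ (Fin N)) : lightConeLift T φ f x ≠ 0 := by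
  intro h0
  have hw : lorentz (lightConeLift T φ f x) T.w = (φ x)⁻¹ := by
    rw [lightConeLift, lorentz_smul_left, T.lorentz_embed_w, mul_one]
  rw [h0, lorentz_zero_left] at hw
  exact inv_ne_zero hφ hw.symm

theorem LightConeTriple.contDiff_embed : ContDiff ℝ ∞ T.embed :=
  (contDiff_const.add T.A.toContinuousLinearMap.contDiff).sub
    ((contDiff_const.mul (contDiff_norm_sq ℝ)).smul contDiff_const)

variable [NormedAddCommGroup X] [NormedSpace ℝ X] {f : X → EuclideanSpace ℝ (Fin N)} {x : X}

theorem LightConeTriple.dirDeriv_embed_comp (hf : DifferentiableAt ℝ f x) (u : X) :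
    dirDeriv u (fun y => T.embed (f y)) x
      = T.A (dirDeriv u f x) - (inner ℝ (f x) (dirDeriv u f x) : ℝ) • T.w := by
  have h := ((T.A.toContinuousLinearMap.hasFDerivAt.comp x hf.hasFDerivAt).const_add T.p₀).sub
    (((hf.hasFDerivAt.norm_sq).const_mul (1 / 2)).smul_const T.w)
  rw [dirDeriv, HasFDerivAt.fderiv (f := fun y => T.embed (f y)) h]
  simp [dirDeriv]

theorem LightConeTriple.lorentz_dirDeriv_smul_embed {ρ : X → ℝ} (hρ : DifferentiableAt ℝ ρ x)
    (hf : DifferentiableAt ℝ f x) (u v : X) :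
    lorentz (dirDeriv u (fun y => ρ y • T.embed (f y)) x)
        (dirDeriv v (fun y => ρ y • T.embed (f y)) x)
      = ρ x ^ 2 * inner ℝ (dirDeriv u f x) (dirDeriv v f x) := by
  have hembed : DifferentiableAt ℝ (fun y => T.embed (f y)) x :=
    (T.contDiff_embed.differentiable (by simp)).differentiableAt.comp x hf
  rw [dirDeriv_smul hρ hembed, dirDeriv_smul hρ hembed, T.dirDeriv_embed_comp hf,
    T.dirDeriv_embed_comp hf]
  simp only [lorentz_add_left, lorentz_add_right, lorentz_smul_left, lorentz_smul_right,
    lorentz_sub_left, lorentz_sub_right, T.lorentz_embed_self, T.lorentz_embed_A,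
    T.lorentz_embed_w, lorentz_comm (T.A _) (T.embed _), lorentz_comm T.w (T.embed _), T.lorentz_A,
    T.lorentz_A_w, T.lorentz_w_A, T.lorentz_w_w]
  ring

end lift

theorem IsConformalImmersionOn.isLightConeImmersion {ι : Type*} [Fintype ι]
    {E : ι → Type*} [∀ i, NormedAddCommGroup (E i)] [∀ i, NormedSpace ℝ (E i)]
    {B : ∀ i, Set (E i)} {h : ∀ i, E i → E i →L[ℝ] E i →L[ℝ] ℝ} {φ : (∀ i, E i) → ℝ} {N : ℕ}
    {f : (∀ i, E i) → EuclideanSpace ℝ (Fin N)}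
    (hf : IsConformalImmersionOn h φ (Set.univ.pi B) f) (T : LightConeTriple N) {i j : ι}
    [Nontrivial (E i)] [Nontrivial (E j)] (hij : i ≠ j) :
    IsLightConeImmersion h (Set.univ.pi B) (lightConeLift T φ f) := by
  have hφ : ContDiffOn ℝ ∞ (fun x => (φ x)⁻¹) (Set.univ.pi B) :=
    (hf.contDiffOn_factor hij).inv fun x hx => (hf.factor_pos x hx).ne'
  refine ⟨hf.isOpen, hφ.smul (T.contDiff_embed.comp_contDiffOn hf.contDiffOn),
    fun x _ => lorentz_lightConeLift_self T φ f x,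
    fun x hx => lightConeLift_ne_zero T (hf.factor_pos x hx).ne' f, hf.pos, fun x hx u v => ?_⟩
  refine (T.lorentz_dirDeriv_smul_embed (differentiableAt_of_contDiffOn hφ hf.isOpen hx)
    (differentiableAt_of_contDiffOn hf.contDiffOn hf.isOpen hx) u v).trans ?_
  rw [hf.conformal x hx, ← mul_assoc, ← mul_pow, inv_mul_cancel₀ (hf.factor_pos x hx).ne', one_pow,
    one_mul]

theorem IsLightConeImmersion.hasZeroMixedDifferencesOn {ι : Type*} [Fintype ι] [DecidableEq ι]
    {E : ι → Type*} [∀ i, NormedAddCommGroup (E i)] [∀ i, NormedSpace ℝ (E i)]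
    [∀ i, FiniteDimensional ℝ (E i)] {B : ∀ i, Set (E i)} {h : ∀ i, E i → E i →L[ℝ] E i →L[ℝ] ℝ}
    {N : ℕ} {F : (∀ i, E i) → Minkowski (N + 1)} (hF : IsLightConeImmersion h (Set.univ.pi B) F)
    (hBc : ∀ i, Convex ℝ (B i)) (hN : Module.finrank ℝ (∀ i, E i) = N) (hN3 : 3 ≤ N) :
    HasZeroMixedDifferencesOn F B :=
  hasZeroMixedDifferencesOn_of_dirDeriv_dirDeriv_eq_zero hF.isOpen hBc hF.contDiffOn
    fun _ _ hij u v _ hx => hF.dirDeriv_single_dirDeriv_single_eq_zero hN hN3 hij u v hx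

/-! ### The lift in product charts -/

theorem exists_convex_subset_extChartAt_target {E H X : Type*} [NormedAddCommGroup E]
    [NormedSpace ℝ E] [TopologicalSpace H] (I : ModelWithCorners ℝ E H) [I.Boundaryless]
    [TopologicalSpace X] [ChartedSpace H X] (x : X) :
    ∃ B, IsOpen B ∧ Convex ℝ B ∧ extChartAt I x x ∈ B ∧ B ⊆ (extChartAt I x).target := by
  obtain ⟨r, hr, hball⟩ := Metric.mem_nhds_iff.1 (extChartAt_target_mem_nhds (I := I) x)
  exact ⟨_, Metric.isOpen_ball, convex_ball _ r, Metric.mem_ball_self hr, hball⟩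

section PiChart
variable {ι : Type*} [Fintype ι] {E H M : ι → Type*} [∀ i, NormedAddCommGroup (E i)]
  [∀ i, NormedSpace ℝ (E i)] [∀ i, TopologicalSpace (H i)] [∀ i, TopologicalSpace (M i)]
  [∀ i, ChartedSpace (H i) (M i)] {I : ∀ i, ModelWithCorners ℝ (E i) (H i)} {Y : Type*}

theorem extChartAt_pi_symm_apply_of_mem {p q : ∀ i, M i}
    (hq : ∀ i, q i ∈ (extChartAt (I i) (p i)).source) :
    (extChartAt (ModelWithCorners.pi I) p).symm (fun i => extChartAt (I i) (p i) (q i)) = q := by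
  rw [extChartAt_pi]
  exact funext fun i => (extChartAt (I i) (p i)).left_inv (hq i)

variable [DecidableEq ι]

theorem extChartAt_pi_symm_update (p : ∀ i, M i) (x : ∀ i, E i) (i : ι) (y : E i) :
    (extChartAt (ModelWithCorners.pi I) p).symm (Function.update x i y)
      = Function.update ((extChartAt (ModelWithCorners.pi I) p).symm x) i
        ((extChartAt (I i) (p i)).symm y) := by
  rw [extChartAt_pi]
  exact funext (Function.apply_update (fun l => (extChartAt (I l) (p l)).symm) x i y)

theorem HasZeroMixedDifferencesOn.of_comp_extChartAt_symm [AddCommGroup Y] {F : (∀ i, M i) → Y}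
    {p : ∀ i, M i} {B : ∀ i, Set (E i)}
    (hF : HasZeroMixedDifferencesOn (F ∘ (extChartAt (ModelWithCorners.pi I) p).symm) B) :
    HasZeroMixedDifferencesOn F
      fun i => (extChartAt (I i) (p i)).source ∩ extChartAt (I i) (p i) ⁻¹' B i := by
  intro i j hij q hq y hy t ht
  have hdiff := hF i j hij (fun l => extChartAt (I l) (p l) (q l)) (fun l => (hq l).2) _ hy.2 _ ht.2
  simpa only [Function.comp_apply, extChartAt_pi_symm_update,
    extChartAt_pi_symm_apply_of_mem fun l => (hq l).1, (extChartAt (I i) (p i)).left_inv hy.1,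
    (extChartAt (I j) (p j)).left_inv ht.1] using hdiff

theorem comp_update_comp_extChartAt_symm (F : (∀ i, M i) → Y) (p : ∀ i, M i) (i : ι) :
    (fun y => F (Function.update p i y)) ∘ (extChartAt (I i) (p i)).symm
      = (F ∘ (extChartAt (ModelWithCorners.pi I) p).symm)
        ∘ Function.update (extChartAt (ModelWithCorners.pi I) p p) i := by
  funext y
  simp only [Function.comp_apply, extChartAt_pi_symm_update, extChartAt_to_inv]

variable [NormedAddCommGroup Y] [NormedSpace ℝ Y]

theorem dirDeriv_comp_update {F : (∀ i, E i) → Y} {x : ∀ i, E i} (hF : DifferentiableAt ℝ F x)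
    (i : ι) (u : E i) :
    dirDeriv u (F ∘ Function.update x i) (x i) = dirDeriv (Pi.single i u) F x := by
  have hFx : DifferentiableAt ℝ F (Function.update x i (x i)) := by rwa [Function.update_eq_self]
  rw [dirDeriv, (hFx.hasFDerivAt.comp (x i) (hasFDerivAt_update (𝕜 := ℝ) x (x i))).fderiv,
    Function.update_eq_self, dirDeriv, ContinuousLinearMap.comp_apply]
  congr 1
  ext l
  rcases eq_or_ne l i with rfl | hl
  · simp
  · simp [hl]

theorem contMDiffAt_comp_update {F : (∀ i, M i) → Y} {p : ∀ i, M i}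
    (hF : ContDiffAt ℝ ∞ (F ∘ (extChartAt (ModelWithCorners.pi I) p).symm)
      (extChartAt (ModelWithCorners.pi I) p p)) (i : ι) :
    ContMDiffAt (I i) 𝓘(ℝ, Y) ∞ (fun y => F (Function.update p i y)) (p i) := by
  have hself : Function.update (extChartAt (ModelWithCorners.pi I) p p) i
      (extChartAt (I i) (p i) (p i)) = extChartAt (ModelWithCorners.pi I) p p := by
    rw [extChartAt_pi]
    exact Function.update_eq_self ..
  have hslice : ContDiffAt ℝ ∞ ((F ∘ (extChartAt (ModelWithCorners.pi I) p).symm)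
      ∘ Function.update (extChartAt (ModelWithCorners.pi I) p p) i)
      (extChartAt (I i) (p i) (p i)) := by
    refine ContDiffAt.comp _ ?_ (contDiff_update ∞ _ i).contDiffAt
    rwa [hself]
  rw [← comp_update_comp_extChartAt_symm] at hslice
  refine (hslice.contMDiffAt.comp (p i) contMDiffAt_extChartAt).congr_of_eventuallyEq ?_
  filter_upwards [extChartAt_source_mem_nhds (I := I i) (p i)] with y hy
  simp only [Function.comp_apply, (extChartAt (I i) (p i)).left_inv hy]

end PiChart

section ConformalImmersion
variable {k : ℕ} {n : Fin k → ℕ} {M : Fin k → Type*}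
  [∀ i, TopologicalSpace (M i)] [∀ i, ChartedSpace (EuclideanSpace ℝ (Fin (n i))) (M i)]
  [∀ i, IsManifold (𝓡 (n i)) ∞ (M i)] {N : ℕ} {g : ∀ i, RiemMetric (n i) (M i)}
  {p : ∀ i, M i} {B : ∀ i, Set (EuclideanSpace ℝ (Fin (n i)))}

theorem isConformalImmersionOn_comp_extChartAt_symm {Y : Type*} [NormedAddCommGroup Y]
    [InnerProductSpace ℝ Y] {f : (∀ i, M i) → Y}
    (hf : ContMDiff (prodModel n) 𝓘(ℝ, Y) ∞ f) {φ : (∀ i, M i) → ℝ} (hφ : ∀ p, 0 < φ p)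
    (hconf : ∀ (p : ∀ i, M i) (u v : TangentSpace (prodModel n) p),
      inner ℝ (mvfderiv (prodModel n) f p u) (mvfderiv (prodModel n) f p v)
        = φ p ^ 2 * productMetric g p u v)
    (hB : ∀ i, IsOpen (B i)) (hBt : ∀ i, B i ⊆ (extChartAt (𝓡 (n i)) (p i)).target) :
    IsConformalImmersionOn (fun i => chartMetric (g i) (p i))
      (φ ∘ (extChartAt (prodModel n) p).symm) (Set.univ.pi B)
      (f ∘ (extChartAt (prodModel n) p).symm) := by
  have hU : Set.univ.pi B ⊆ (extChartAt (prodModel n) p).target := fun x hx =>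
    mem_extChartAt_pi_target.2 fun i => hBt i (hx i trivial)
  refine ⟨isOpen_set_pi Set.finite_univ fun i _ => hB i,
    (contDiffOn_comp_extChartAt_symm hf p).mono hU, fun x _ => hφ _,
    fun x hx i v hv => chartMetric_pos (g i) (hBt i (hx i trivial)) hv, fun x hx u v => ?_⟩
  have hfx := hf.mdifferentiableAt (x := (extChartAt (prodModel n) p).symm x) (by simp)
  rw [dirDeriv_comp_extChartAt_symm (hU hx) hfx, dirDeriv_comp_extChartAt_symm (hU hx) hfx, hconf,
    productMetric]
  simp only [mfderiv_apply_chartFrame p (hU hx)]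
  rfl

namespace IsLightConeImmersion
variable {F : (∀ i, M i) → Minkowski (N + 1)} {U : Set (∀ i, EuclideanSpace ℝ (Fin (n i)))}

theorem contMDiffAt_comp_update (hF : IsLightConeImmersion (fun i => chartMetric (g i) (p i)) U
      (F ∘ (extChartAt (prodModel n) p).symm)) (hp : extChartAt (prodModel n) p p ∈ U)
    (i : Fin k) : ContMDiffAt (𝓡 (n i)) 𝓘(ℝ, Minkowski (N + 1)) ∞
      (fun y => F (Function.update p i y)) (p i) :=
  _root_.contMDiffAt_comp_update (hF.contDiffOn.contDiffAt (hF.isOpen.mem_nhds hp)) i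

theorem lorentz_mvfderiv_comp_update
    (hF : IsLightConeImmersion (fun i => chartMetric (g i) (p i)) U
      (F ∘ (extChartAt (prodModel n) p).symm)) (hp : extChartAt (prodModel n) p p ∈ U)
    (i : Fin k) (u v : TangentSpace (𝓡 (n i)) (p i)) :
    lorentz (mvfderiv (𝓡 (n i)) (fun y => F (Function.update p i y)) (p i) u)
        (mvfderiv (𝓡 (n i)) (fun y => F (Function.update p i y)) (p i) v)
      = (g i).inner (p i) u v := by
  refine isometric_of_extChartAt (g i) lorentz
    ((hF.contMDiffAt_comp_update hp i).mdifferentiableAt (by simp)) (fun u v => ?_) u v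
  have hFp := differentiableAt_of_contDiffOn hF.contDiffOn hF.isOpen hp
  have hslice : ∀ u, dirDeriv u ((fun y => F (Function.update p i y))
      ∘ (extChartAt (𝓡 (n i)) (p i)).symm) (extChartAt (𝓡 (n i)) (p i) (p i))
      = dirDeriv (Pi.single i u) (F ∘ (extChartAt (prodModel n) p).symm)
        (extChartAt (prodModel n) p p) := fun u => by
    rw [comp_update_comp_extChartAt_symm (I := fun i => 𝓡 (n i))]
    exact dirDeriv_comp_update hFp i u
  rw [hslice, hslice, hF.isometric _ hp, Finset.sum_eq_single i]
  · rw [Pi.single_eq_same, Pi.single_eq_same]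
    rfl
  · intro l _ hl
    simp [Pi.single_eq_of_ne hl]
  · simp

end IsLightConeImmersion

theorem exists_isLightConeImmersion_comp_extChartAt_symm (T : LightConeTriple N) (hk : 2 ≤ k)
    (hn : ∀ i, 1 ≤ n i) {f : (∀ i, M i) → EuclideanSpace ℝ (Fin N)}
    (hf : ContMDiff (prodModel n) (𝓡 N) ∞ f) {φ : (∀ i, M i) → ℝ} (hφ : ∀ p, 0 < φ p)
    (hconf : ∀ (p : ∀ i, M i) (u v : TangentSpace (prodModel n) p),
      inner ℝ (mvfderiv (prodModel n) f p u) (mvfderiv (prodModel n) f p v)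
        = φ p ^ 2 * productMetric g p u v) (p : ∀ i, M i) :
    ∃ B : ∀ i, Set (EuclideanSpace ℝ (Fin (n i))),
      (∀ i, IsOpen (B i)) ∧ (∀ i, Convex ℝ (B i)) ∧ extChartAt (prodModel n) p p ∈ Set.univ.pi B ∧
      IsLightConeImmersion (fun i => chartMetric (g i) (p i)) (Set.univ.pi B)
        (lightConeLift T φ f ∘ (extChartAt (prodModel n) p).symm) := by
  choose B hB hBc hpB hBt using
    fun i => exists_convex_subset_extChartAt_target (𝓡 (n i)) (p i)
  have : Nontrivial (Fin k) := Fin.nontrivial_iff_two_le.2 hk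
  have (i : Fin k) : Nontrivial (EuclideanSpace ℝ (Fin (n i))) :=
    Module.nontrivial_of_finrank_pos (R := ℝ) (by rw [finrank_euclideanSpace_fin]; exact hn i)
  obtain ⟨i, j, hij⟩ := exists_pair_ne (Fin k)
  refine ⟨B, hB, hBc, fun i _ => ?_,
    (isConformalImmersionOn_comp_extChartAt_symm hf hφ hconf hB hBt).isLightConeImmersion T hij⟩
  rw [extChartAt_pi]
  exact hpB i

theorem exists_lightCone_splitting [∀ i, PreconnectedSpace (M i)] (T : LightConeTriple N)
    (hk : 2 ≤ k) (hn : ∀ i, 1 ≤ n i) (hN : ∑ i, n i = N) (hN3 : 3 ≤ N)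
    {f : (∀ i, M i) → EuclideanSpace ℝ (Fin N)} (hf : IsConformalLocalDiffeo g f) (o : ∀ i, M i) :
    ∃ (ρ : (∀ i, M i) → ℝ) (G : ∀ i, M i → Minkowski (N + 1)), (∀ p, 0 < ρ p) ∧
      (∀ p, ρ p • T.embed (f p) = ρ o • T.embed (f o) + ∑ i, G i (p i)) ∧ (∀ i, G i (o i) = 0) ∧
      (∀ i, ContMDiff (𝓡 (n i)) 𝓘(ℝ, Minkowski (N + 1)) ∞ (G i)) ∧
      ∀ i (x : M i) (u v : TangentSpace (𝓡 (n i)) x),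
        lorentz (mvfderiv (𝓡 (n i)) (G i) x u) (mvfderiv (𝓡 (n i)) (G i) x v)
          = (g i).inner x u v := by
  obtain ⟨φ, hφ, hconf⟩ := hf.conformal
  choose B hB hBc hpB hF using exists_isLightConeImmersion_comp_extChartAt_symm T hk hn
    hf.isLocalDiffeomorph.contMDiff hφ hconf
  let F := lightConeLift T φ f
  have hmixed : HasZeroMixedDifferencesOn F fun _ => Set.univ :=
    hasZeroMixedDifferencesOn_univ_of_locally fun p =>
      ⟨_, fun i => Filter.inter_mem (extChartAt_source_mem_nhds (p i))
          ((continuousAt_extChartAt (p i)).preimage_mem_nhds ((hB p i).mem_nhds (by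
            simpa only [extChartAt_pi] using! hpB p i trivial))),
        ((hF p).hasZeroMixedDifferencesOn (hBc p) (by simp [Module.finrank_pi_fintype, hN])
          hN3).of_comp_extChartAt_symm⟩
  have hslice : ∀ i x, ContMDiffAt (𝓡 (n i)) 𝓘(ℝ, Minkowski (N + 1)) ∞
      (fun y => F (Function.update o i y)) x := fun i x => by
    have hx := (hF (Function.update o i x)).contMDiffAt_comp_update (hpB _) i
    simpa only [Function.update_idem, Function.update_self] using hx
  refine ⟨fun p => (φ p)⁻¹, fun i x => F (Function.update o i x) - F o, fun p => inv_pos.2 (hφ p),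
    fun p => hmixed.eq_add_sum o p, by simp, fun i x => (hslice i x).sub contMDiffAt_const, ?_⟩
  intro i x u v
  rw [mvfderiv_fun_sub ((hslice i x).mdifferentiableAt (by simp)) mdifferentiableAt_const,
    mvfderiv_const, sub_zero]
  have hiso := (hF (Function.update o i x)).lorentz_mvfderiv_comp_update (hpB _) i
  simp only [Function.update_idem] at hiso
  rw [Function.update_self] at hiso
  exact hiso u v

end ConformalImmersion

/-! ### The map `Θ` is a conformal diffeomorphism -/

namespace LightConeTriple
variable {N : ℕ} (T : LightConeTriple N)

theorem lorentzAdjoint_embed (x : EuclideanSpace ℝ (Fin N)) :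
    lorentzAdjoint T.A (T.embed x) = x :=
  ext_inner_right ℝ fun y => by rw [inner_lorentzAdjoint, lorentz_embed_A]

theorem eq_smul_w_add_A_lorentzAdjoint {z : Minkowski (N + 1)} (hz : lorentz z T.w = 0) :
    z = lorentz z T.p₀ • T.w + T.A (lorentzAdjoint T.A z) := by
  obtain ⟨a, b, x, rfl⟩ := T.exists_decomp z
  have ha : a = 0 := by
    simpa [lorentz_add_left, lorentz_smul_left, T.lorentz_p₀_w, T.lorentz_w_w, T.lorentz_A_w]
      using hz
  have hx : lorentzAdjoint T.A (a • T.p₀ + b • T.w + T.A x) = x := ext_inner_right ℝ fun y => by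
    rw [inner_lorentzAdjoint]
    simp [lorentz_add_left, lorentz_smul_left, T.lorentz_p₀_A, T.lorentz_w_A, T.lorentz_A]
  rw [hx, ha]
  simp [lorentz_add_left, lorentz_smul_left, T.lorentz_w_p₀, T.lorentz_A_p₀]

theorem inner_lorentzAdjoint_lorentzAdjoint {y z : Minkowski (N + 1)} (hy : lorentz y T.w = 0)
    (hz : lorentz z T.w = 0) :
    inner ℝ (lorentzAdjoint T.A y) (lorentzAdjoint T.A z) = lorentz y z := by
  conv_rhs => rw [T.eq_smul_w_add_A_lorentzAdjoint hz]
  rw [inner_lorentzAdjoint, lorentz_add_right, lorentz_smul_right, hy, mul_zero, zero_add]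

theorem toEuclidean_eq_smul (z : Minkowski (N + 1)) :
    T.toEuclidean z = (lorentz z T.w)⁻¹ • lorentzAdjoint T.A z := by
  ext j
  exact div_eq_inv_mul _ _

variable {z : Minkowski (N + 1)} (hz : lorentz z T.w ≠ 0)
include hz

theorem contDiffAt_toEuclidean : ContDiffAt ℝ ∞ T.toEuclidean z := by
  have hw : ContDiffAt ℝ ∞ (fun z => lorentz z T.w) z :=
    ((lorentzL _).flip T.w).contDiff.contDiffAt
  rw [funext T.toEuclidean_eq_smul]
  exact (hw.inv hz).smul (lorentzAdjoint T.A).contDiff.contDiffAt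

theorem dirDeriv_toEuclidean (u : Minkowski (N + 1)) :
    dirDeriv u T.toEuclidean z
      = (lorentz z T.w)⁻¹ • lorentzAdjoint T.A (u - (lorentz u T.w / lorentz z T.w) • z) := by
  have hw : HasFDerivAt (fun z => (lorentz z T.w)⁻¹)
      (-(lorentz z T.w ^ 2)⁻¹ • (lorentzL _).flip T.w) z :=
    (hasDerivAt_inv hz).comp_hasFDerivAt z ((lorentzL _).flip T.w).hasFDerivAt
  have hinv : dirDeriv u (fun z => (lorentz z T.w)⁻¹) z
      = -(lorentz z T.w ^ 2)⁻¹ * lorentz u T.w := by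
    rw [dirDeriv, hw.fderiv]
    rfl
  have hadj : dirDeriv u (lorentzAdjoint T.A) z = lorentzAdjoint T.A u := by
    rw [dirDeriv, ContinuousLinearMap.fderiv]
  rw [funext T.toEuclidean_eq_smul, dirDeriv_smul hw.differentiableAt
    (lorentzAdjoint T.A).differentiableAt, hinv, hadj, map_sub, map_smul]
  module

theorem inner_dirDeriv_toEuclidean (hzz : lorentz z z = 0) {u v : Minkowski (N + 1)}
    (hu : lorentz z u = 0) (hv : lorentz z v = 0) :
    inner ℝ (dirDeriv u T.toEuclidean z) (dirDeriv v T.toEuclidean z)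
      = |lorentz z T.w|⁻¹ ^ 2 * lorentz u v := by
  have hproj : ∀ u, lorentz (u - (lorentz u T.w / lorentz z T.w) • z) T.w = 0 := fun u => by
    rw [lorentz_sub_left, lorentz_smul_left, div_mul_cancel₀ _ hz, sub_self]
  rw [T.dirDeriv_toEuclidean hz, T.dirDeriv_toEuclidean hz, real_inner_smul_left,
    real_inner_smul_right, T.inner_lorentzAdjoint_lorentzAdjoint (hproj u) (hproj v),
    lorentz_sub_left, lorentz_sub_right, lorentz_sub_right, lorentz_smul_left, lorentz_smul_left,
    lorentz_smul_right, lorentz_smul_right, hzz, hv, lorentz_comm u z, hu, inv_pow, sq_abs]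
  ring

end LightConeTriple

namespace LorentzSplitting
variable {N m n : ℕ} (S : LorentzSplitting N m n)

theorem lorentz_C_add_D (X X' : Minkowski m) (Y Y' : EuclideanSpace ℝ (Fin (n + 1))) :
    lorentz (S.C X + S.D Y) (S.C X' + S.D Y') = lorentz X X' + inner ℝ Y Y' := by
  rw [lorentz_add_left, lorentz_add_right, lorentz_add_right, S.lorentz_C, S.lorentz_D,
    S.lorentz_C_D, lorentz_comm (S.D Y), S.lorentz_C_D, add_zero, zero_add]

theorem injective : Function.Injective (S.C.coprod S.D) := by
  rw [injective_iff_map_eq_zero]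
  rintro ⟨X, Y⟩ h
  rw [LinearMap.coprod_apply] at h
  have horth : ∀ X' Y', lorentz X X' + inner ℝ Y Y' = 0 := fun X' Y' => by
    rw [← S.lorentz_C_add_D, h, lorentz_zero_left]
  have hX : X = 0 := by
    have hXX := horth (timeReversal X) 0
    rw [lorentz_comm, lorentz_timeReversal, inner_zero_right, add_zero] at hXX
    exact inner_self_eq_zero.1 hXX
  have hY : Y = 0 := by
    have hYY := horth 0 Y
    rw [lorentz_zero_right, zero_add] at hYY
    exact inner_self_eq_zero.1 hYY
  rw [hX, hY, Prod.mk_zero_zero]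

theorem surjective : Function.Surjective (S.C.coprod S.D) := by
  have hdim := S.dim
  exact (LinearMap.injective_iff_surjective_of_finrank_eq_finrank (by simp; omega)).1 S.injective

end LorentzSplitting

theorem last_ne_zero_of_lorentz_self_neg {m : ℕ} {X : Minkowski m} (hX : lorentz X X < 0) :
    X (Fin.last m) ≠ 0 := by
  intro hlast
  rw [lorentz, hlast, mul_zero, sub_zero] at hX
  exact hX.not_ge (Finset.sum_nonneg fun i _ => mul_self_nonneg _)

theorem exists_smul_mem_hyperbolic {m : ℕ} {c : ℝ} (hc : 0 < c) {X : Minkowski m}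
    (hX : lorentz X X < 0) : ∃ r : ℝ, r • X ∈ hyperbolic m c := by
  have hs : 0 < 1 / (c * -lorentz X X) := one_div_pos.2 (mul_pos hc (neg_pos.2 hX))
  have hnorm : ∀ r : ℝ, r ^ 2 = 1 / (c * -lorentz X X) →
      lorentz (r • X) (r • X) = -1 / c := fun r hr => by
    rw [lorentz_smul_left, lorentz_smul_right, ← mul_assoc, ← sq, hr]
    field_simp [hX.ne]
  rcases (last_ne_zero_of_lorentz_self_neg hX).lt_or_gt with hneg | hpos
  · exact ⟨-√_, hnorm _ (by rw [neg_sq, Real.sq_sqrt hs.le]),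
      mul_pos_of_neg_of_neg (neg_neg_of_pos (Real.sqrt_pos.2 hs)) hneg⟩
  · exact ⟨√_, hnorm _ (Real.sq_sqrt hs.le), mul_pos (Real.sqrt_pos.2 hs) hpos⟩

theorem eq_one_of_smul_mem_hyperbolic {m : ℕ} {c r : ℝ} (hc : 0 < c) {X : Minkowski m}
    (hX : X ∈ hyperbolic m c) (hrX : r • X ∈ hyperbolic m c) : r = 1 := by
  have hr : 0 < r := pos_of_mul_pos_left hrX.2 hX.2.le
  have hsq := hrX.1
  rw [lorentz_smul_left, lorentz_smul_right, hX.1, ← mul_assoc,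
    mul_eq_right₀ (div_ne_zero (by simp) hc.ne')] at hsq
  exact (mul_self_eq_one_iff.1 hsq).resolve_right (by linarith)

section Theta
variable {N m n : ℕ} (T : LightConeTriple N) (S : LorentzSplitting N m n) {c : ℝ}

theorem lorentz_self_of_mem_thetaDomain {q : Minkowski m × EuclideanSpace ℝ (Fin (n + 1))}
    (hq : q ∈ thetaDomain T S c) :
    lorentz (S.C q.1 + S.D q.2) (S.C q.1 + S.D q.2) = 0 := by
  rw [S.lorentz_C_add_D, hq.1.1, hq.2.1]
  ring

theorem embed_conformalTheta {q : Minkowski m × EuclideanSpace ℝ (Fin (n + 1))}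
    (hq : q ∈ thetaDomain T S c) :
    T.embed (conformalTheta T S q)
      = (lorentz (S.C q.1 + S.D q.2) T.w)⁻¹ • S.C.coprod S.D q :=
  T.embed_toEuclidean (lorentz_self_of_mem_thetaDomain T S hq) hq.2.2

theorem injOn_conformalTheta (hc : 0 < c) :
    Set.InjOn (conformalTheta T S) (thetaDomain T S c) := by
  intro q hq q' hq' h
  have hembed := congrArg T.embed h
  rw [embed_conformalTheta T S hq, embed_conformalTheta T S hq', ← map_smul, ← map_smul] at hembed
  have hsmul := (inv_smul_eq_iff₀ hq.2.2).1 (S.injective hembed)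
  rw [smul_smul] at hsmul
  have hmem := hq.1
  rw [hsmul, Prod.smul_fst] at hmem
  rw [hsmul, eq_one_of_smul_mem_hyperbolic hc hq'.1 hmem, one_smul]

theorem exists_lorentz_D_ne_zero_of_mem_image (hc : c ≠ 0) {x : EuclideanSpace ℝ (Fin N)}
    (hx : x ∈ conformalTheta T S '' thetaDomain T S c) : ∃ Y, lorentz (T.embed x) (S.D Y) ≠ 0 := by
  obtain ⟨q, hq, rfl⟩ := hx
  refine ⟨q.2, ?_⟩
  rw [embed_conformalTheta T S hq, lorentz_smul_left]
  refine mul_ne_zero (inv_ne_zero hq.2.2) ?_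
  rw [LinearMap.coprod_apply, lorentz_add_left, S.lorentz_C_D, S.lorentz_D, hq.2.1, zero_add]
  exact one_div_ne_zero hc

theorem mem_image_conformalTheta (hc : 0 < c) {x : EuclideanSpace ℝ (Fin N)}
    {Y₀ : EuclideanSpace ℝ (Fin (n + 1))} (hY₀ : lorentz (T.embed x) (S.D Y₀) ≠ 0) :
    x ∈ conformalTheta T S '' thetaDomain T S c := by
  obtain ⟨⟨X, Y⟩, hXY⟩ := S.surjective (T.embed x)
  rw [LinearMap.coprod_apply] at hXY
  have hY : Y ≠ 0 := by
    rintro rfl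
    rw [← hXY, lorentz_add_left, S.lorentz_C_D, S.lorentz_D, inner_zero_left, add_zero] at hY₀
    exact hY₀ rfl
  have hnull : lorentz X X + inner ℝ Y Y = 0 := by
    rw [← S.lorentz_C_add_D, hXY, T.lorentz_embed_self]
  have hXneg : lorentz X X < 0 := by
    rw [eq_neg_of_add_eq_zero_left hnull]
    exact neg_neg_of_pos (real_inner_self_pos.2 hY)
  obtain ⟨r, hr⟩ := exists_smul_mem_hyperbolic hc hXneg
  have hr₀ : r ≠ 0 := by
    rintro rfl
    simpa using hr.2
  have hz : S.C (r • X) + S.D (r • Y) = r • T.embed x := by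
    rw [map_smul, map_smul, ← smul_add, hXY]
  refine ⟨(r • X, r • Y), ⟨hr, ?_, ?_⟩, ?_⟩
  · have hX := hr.1
    rw [lorentz_smul_left, lorentz_smul_right, eq_neg_of_add_eq_zero_left hnull] at hX
    change inner ℝ (r • Y) (r • Y) = 1 / c
    rw [real_inner_smul_left, real_inner_smul_right]
    linear_combination -hX
  · change lorentz (S.C (r • X) + S.D (r • Y)) T.w ≠ 0
    rwa [hz, lorentz_smul_left, T.lorentz_embed_w, mul_one]
  · change T.toEuclidean (S.C (r • X) + S.D (r • Y)) = x
    rw [hz, T.toEuclidean_smul_embed hr₀]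

theorem image_conformalTheta (hc : 0 < c) :
    conformalTheta T S '' thetaDomain T S c = {x | ∃ Y, lorentz (T.embed x) (S.D Y) ≠ 0} :=
  Set.ext fun _ => ⟨exists_lorentz_D_ne_zero_of_mem_image T S hc.ne',
    fun ⟨_, hY⟩ => mem_image_conformalTheta T S hc hY⟩

theorem isOpen_image_conformalTheta (hc : 0 < c) :
    IsOpen (conformalTheta T S '' thetaDomain T S c) := by
  rw [image_conformalTheta T S hc, Set.ofPred_exists]
  refine isOpen_iUnion fun Y => ?_
  have hY : Continuous fun x => lorentz (T.embed x) (S.D Y) :=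
    ((lorentzL _).flip (S.D Y)).continuous.comp T.contDiff_embed.continuous
  exact isOpen_ne_fun hY continuous_const

theorem isConformalDiffeoOn_conformalTheta (hc : 0 < c) :
    IsConformalDiffeoOn (thetaDomain T S c) (conformalTheta T S) := by
  let J : Minkowski m × EuclideanSpace ℝ (Fin (n + 1)) →L[ℝ] Minkowski (N + 1) :=
    (S.C.coprod S.D).toContinuousLinearMap
  have hsmooth : ∀ q ∈ thetaDomain T S c, ContDiffAt ℝ ∞ T.toEuclidean (J q) := fun q hq =>
    T.contDiffAt_toEuclidean hq.2.2
  have hfderiv : ∀ q ∈ thetaDomain T S c, ∀ v,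
      fderiv ℝ (conformalTheta T S) q v = dirDeriv (J v) T.toEuclidean (J q) := fun q hq v =>
    congrArg (fun L => L v)
      (((hsmooth q hq).differentiableAt (by simp)).hasFDerivAt.comp q J.hasFDerivAt).fderiv
  refine ⟨injOn_conformalTheta T S hc, isOpen_image_conformalTheta T S hc,
    fun q hq => (hsmooth q hq).comp q J.contDiff.contDiffAt,
    fun q => |lorentz (J q) T.w|⁻¹, fun q hq => inv_pos.2 (abs_pos.2 hq.2.2), ?_⟩
  intro q hq u u' v v' hu hu' hv hv'
  have htangent : ∀ u v, lorentz q.1 u = 0 → inner ℝ q.2 v = 0 → lorentz (J q) (J (u, v)) = 0 :=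
    fun u v hu hv => (S.lorentz_C_add_D q.1 u q.2 v).trans (by rw [hu, hv, add_zero])
  rw [hfderiv q hq, hfderiv q hq, T.inner_dirDeriv_toEuclidean (z := J q) hq.2.2
    (lorentz_self_of_mem_thetaDomain T S hq) (htangent u v hu hv) (htangent u' v' hu' hv')]
  exact congrArg _ (S.lorentz_C_add_D u u' v v')

end Theta

/-! ### Maps into a vector space of the same dimension -/

section LocalDiffeomorph
variable {E H X : Type*} [NormedAddCommGroup E] [NormedSpace ℝ E] [TopologicalSpace H]
  {I : ModelWithCorners ℝ E H} [TopologicalSpace X] [ChartedSpace H X]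

section mvfderiv
variable {Y Z : Type*} [NormedAddCommGroup Y] [NormedSpace ℝ Y] [NormedAddCommGroup Z]
  [NormedSpace ℝ Z] {G : X → Y} {x : X} {Q : Y → Z} {Q' : Y →L[ℝ] Z}

theorem mvfderiv_comp_of_hasFDerivAt (hG : MDifferentiableAt I 𝓘(ℝ, Y) G x)
    (hQ : HasFDerivAt Q Q' (G x)) (u : TangentSpace I x) :
    mvfderiv I (fun y => Q (G y)) x u = Q' (mvfderiv I G x u) :=
  congrArg (fun L => L u) (hQ.hasMFDerivAt.comp x hG.hasMFDerivAt).mfderiv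

theorem apply_mvfderiv_eq_zero_of_const (hG : MDifferentiableAt I 𝓘(ℝ, Y) G x)
    (hQ : HasFDerivAt Q Q' (G x)) {c : Z} (hc : ∀ y, Q (G y) = c) (u : TangentSpace I x) :
    Q' (mvfderiv I G x u) = 0 := by
  rw [← mvfderiv_comp_of_hasFDerivAt hG hQ, funext hc, mvfderiv_const]
  rfl

end mvfderiv

theorem exists_openPartialHomeomorph_of_injective_fderiv [FiniteDimensional ℝ E] {f : E → E}
    {s : Set E} {y : E} (hs : IsOpen s) (hf : ContDiffOn ℝ ∞ f s)
    (hinj : ∀ z ∈ s, Function.Injective (fderiv ℝ f z)) (hy : y ∈ s) :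
    ∃ R : OpenPartialHomeomorph E E, y ∈ R.source ∧ R.source ⊆ s ∧ Set.EqOn R f R.source ∧
      ContDiffOn ℝ ∞ R.symm R.target := by
  have : CompleteSpace E := FiniteDimensional.complete ℝ E
  have hderiv : ∀ z ∈ s, ∃ L : E ≃L[ℝ] E, HasFDerivAt f (L : E →L[ℝ] E) z := fun z hz =>
    ⟨(LinearEquiv.ofInjectiveEndo _ (hinj z hz)).toContinuousLinearEquiv,
      (hf.differentiableOn (by simp)).hasFDerivAt (hs.mem_nhds hz)⟩
  have hat : ∀ z ∈ s, ContDiffAt ℝ ∞ f z := fun z hz => hf.contDiffAt (hs.mem_nhds hz)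
  obtain ⟨L, hL⟩ := hderiv y hy
  let R := ((hat y hy).toOpenPartialHomeomorph f hL (by simp)).restrOpen s hs
  have hR : R.source ⊆ s := Set.inter_subset_right
  refine ⟨R, ⟨(hat y hy).mem_toOpenPartialHomeomorph_source hL (by simp), hy⟩, hR,
    fun _ _ => rfl, fun z hz => ?_⟩
  have hz' := hR (R.map_target hz)
  obtain ⟨L', hL'⟩ := hderiv _ hz'
  exact (R.contDiffAt_symm hz hL' (hat _ hz')).contDiffWithinAt

variable [I.Boundaryless] [IsManifold I ∞ X] {h : X → E}

theorem injective_fderiv_comp_extChartAt_symm (hh : ContMDiff I 𝓘(ℝ, E) ∞ h)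
    (hinj : ∀ x, Function.Injective (mvfderiv I h x)) {x : X} {y : E}
    (hy : y ∈ (extChartAt I x).target) :
    Function.Injective (fderiv ℝ (h ∘ (extChartAt I x).symm) y) := by
  have hfderiv : ⇑(fderiv ℝ (h ∘ (extChartAt I x).symm) y)
      = mvfderiv I h ((extChartAt I x).symm y) ∘ chartFrame I x y :=
    funext fun u => dirDeriv_comp_extChartAt_symm hy (hh.mdifferentiableAt (by simp)) u
  rw [hfderiv]
  exact (hinj _).comp (bijective_chartFrame hy).1

theorem isLocalDiffeomorph_of_injective_mvfderiv [FiniteDimensional ℝ E]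
    (hh : ContMDiff I 𝓘(ℝ, E) ∞ h)
    (hinj : ∀ x, Function.Injective (mvfderiv I h x)) :
    IsLocalDiffeomorph I 𝓘(ℝ, E) ∞ h := by
  intro x
  let e := extChartAt I x
  obtain ⟨R, hxR, hRe, hRh, hRsymm⟩ := exists_openPartialHomeomorph_of_injective_fderiv
    (isOpen_extChartAt_target x) (contDiffOn_comp_extChartAt_symm hh x)
    (fun y hy => injective_fderiv_comp_extChartAt_symm hh hinj hy) (mem_extChartAt_target x)
  have heq : Set.EqOn h (e.trans R.toPartialEquiv) (e.trans R.toPartialEquiv).source :=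
    fun y hy => ((hRh hy.2).trans (congrArg h (e.left_inv hy.1))).symm
  have htarget : (e.trans R.toPartialEquiv).target = R.target := by
    rw [PartialEquiv.trans_target]
    exact Set.inter_eq_left.2 fun y hy => hRe (R.map_target hy)
  refine ⟨{ toPartialEquiv := e.trans R.toPartialEquiv
            open_source := (continuousOn_extChartAt x).isOpen_inter_preimage
              (isOpen_extChartAt_source x) R.open_source
            open_target := htarget ▸ R.open_target
            contMDiffOn_toFun := hh.contMDiffOn.congr fun y hy => (heq hy).symm
            contMDiffOn_invFun := (contMDiffOn_extChartAt_symm x).comp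
              (hRsymm.contMDiffOn.mono fun y hy => hy.1) fun y hy => hRe (R.map_target hy.1) },
    ⟨mem_extChartAt_source x, hxR⟩, heq⟩

end LocalDiffeomorph

section RiemMetric
variable {m : ℕ} {X : Type*} [TopologicalSpace X] [ChartedSpace (EuclideanSpace ℝ (Fin m)) X]
  [IsManifold (𝓡 m) ∞ X] (g : RiemMetric m X)

theorem isLocalIsometryEuclidean_of_isometric {h : X → EuclideanSpace ℝ (Fin m)}
    (hh : ContMDiff (𝓡 m) (𝓡 m) ∞ h)
    (hiso : ∀ (x : X) (u v : TangentSpace (𝓡 m) x),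
      inner ℝ (mvfderiv (𝓡 m) h x u) (mvfderiv (𝓡 m) h x v) = g.inner x u v) :
    IsLocalIsometryEuclidean g h := by
  refine ⟨isLocalDiffeomorph_of_injective_mvfderiv hh fun x => ?_, hiso⟩
  rw [injective_iff_map_eq_zero]
  intro u hu
  by_contra hu₀
  have hpos := g.pos x u hu₀
  rw [← hiso, hu, inner_zero_left] at hpos
  exact hpos.false

theorem exists_orthonormal_frame_tangentSpace (x : X) :
    ∃ e : EuclideanSpace ℝ (Fin m) ≃ₗ[ℝ] TangentSpace (𝓡 m) x,
      ∀ u v, g.inner x (e u) (e v) = inner ℝ u v :=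
  exists_orthonormal_frame (V := EuclideanSpace ℝ (Fin m))
    (finrank_euclideanSpace_fin (𝕜 := ℝ) (n := m))
    (LinearMap.mk₂ ℝ (fun u v => g.inner x u v)
      (fun _ _ w => DFunLike.congr_fun (map_add (g.inner x) _ _) w)
      (fun _ _ w => DFunLike.congr_fun (map_smul (g.inner x) _ _) w)
      (fun _ _ _ => map_add _ _ _) (fun _ _ _ => map_smul _ _ _))
    (g.symm x) (g.pos x)

end RiemMetric

/-! ### Frames of Minkowski space adapted to a product -/

section SumFrame
variable {k : ℕ} {n : Fin k → ℕ} {N m : ℕ}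
  (A : ∀ i, EuclideanSpace ℝ (Fin (n i)) →ₗ[ℝ] Minkowski m)

/-- The linear map `x ↦ ∑ i, A i (x i)` from the Euclidean product into Minkowski space. -/
def sumFrame : PiLp 2 (fun i => EuclideanSpace ℝ (Fin (n i))) →ₗ[ℝ] Minkowski m :=
  ∑ i, A i ∘ₗ PiLp.projₗ 2 (fun i => EuclideanSpace ℝ (Fin (n i))) i

theorem sumFrame_apply (x : PiLp 2 (fun i => EuclideanSpace ℝ (Fin (n i)))) :
    sumFrame A x = ∑ i, A i (x i) := by
  simp [sumFrame]

theorem sumFrame_single (i : Fin k) (u : EuclideanSpace ℝ (Fin (n i))) :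
    sumFrame A (WithLp.toLp 2 (Pi.single i u)) = A i u := by
  rw [sumFrame_apply, Finset.sum_eq_single i]
  · simp
  · intro j _ hj
    simp [Pi.single_eq_of_ne hj]
  · simp

variable {A}

theorem lorentz_sumFrame_eq_zero {z : Minkowski m} (hz : ∀ i u, lorentz (A i u) z = 0)
    (x : PiLp 2 (fun i => EuclideanSpace ℝ (Fin (n i)))) : lorentz (sumFrame A x) z = 0 := by
  rw [sumFrame_apply, lorentz_sum_left]
  exact Finset.sum_eq_zero fun i _ => hz i _

variable (hA : ∀ i u v, lorentz (A i u) (A i v) = inner ℝ u v)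
  (hA' : ∀ i j, i ≠ j → ∀ u v, lorentz (A i u) (A j v) = 0)
include hA hA'

theorem lorentz_sumFrame_left (x : PiLp 2 (fun i => EuclideanSpace ℝ (Fin (n i)))) (i : Fin k)
    (v : EuclideanSpace ℝ (Fin (n i))) : lorentz (sumFrame A x) (A i v) = inner ℝ (x i) v := by
  rw [sumFrame_apply, lorentz_sum_left, Finset.sum_eq_single i, hA]
  · exact fun j _ hj => hA' j i hj _ _
  · simp

theorem lorentz_sumFrame (x y : PiLp 2 (fun i => EuclideanSpace ℝ (Fin (n i)))) :
    lorentz (sumFrame A x) (sumFrame A y) = inner ℝ x y := by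
  rw [sumFrame_apply A y, lorentz_sum_right, PiLp.inner_apply]
  exact Finset.sum_congr rfl fun i _ => lorentz_sumFrame_left hA hA' x i (y i)

end SumFrame

theorem exists_isometry_piLp {k : ℕ} {n : Fin k → ℕ} {N : ℕ} (hN : ∑ i, n i = N) :
    Nonempty (EuclideanSpace ℝ (Fin N) ≃ₗᵢ[ℝ] PiLp 2 fun i => EuclideanSpace ℝ (Fin (n i))) := by
  have hfinrank : Module.finrank ℝ (PiLp 2 fun i => EuclideanSpace ℝ (Fin (n i))) = N := by
    rw [(WithLp.linearEquiv 2 ℝ (∀ i, EuclideanSpace ℝ (Fin (n i)))).finrank_eq]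
    simp [Module.finrank_pi_fintype, hN]
  exact ⟨((stdOrthonormalBasis ℝ (PiLp 2 fun i => EuclideanSpace ℝ (Fin (n i)))).reindex
    (finCongr hfinrank)).repr.symm⟩

/-- Light-like vectors `o`, `ξ` with `⟨o, ξ⟩ = 1` together with isometries `A i` of the spaces
`ℝ^(n i)` onto mutually orthogonal subspaces which span the orthogonal complement of `o` and `ξ`
(they do so by dimension). -/
structure IsLightConeFrame {k : ℕ} {n : Fin k → ℕ} {N : ℕ} (o ξ : Minkowski (N + 1))
    (A : ∀ i, EuclideanSpace ℝ (Fin (n i)) →ₗ[ℝ] Minkowski (N + 1)) : Prop where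
  dim : ∑ i, n i = N
  lorentz_o_o : lorentz o o = 0
  lorentz_ξ_ξ : lorentz ξ ξ = 0
  lorentz_o_ξ : lorentz o ξ = 1
  lorentz_A : ∀ i u v, lorentz (A i u) (A i v) = inner ℝ u v
  lorentz_A_of_ne : ∀ i j, i ≠ j → ∀ u v, lorentz (A i u) (A j v) = 0
  lorentz_A_o : ∀ i u, lorentz (A i u) o = 0
  lorentz_A_ξ : ∀ i u, lorentz (A i u) ξ = 0

section Frame
variable {k : ℕ} {n : Fin k → ℕ} {N : ℕ} {o ξ : Minkowski (N + 1)}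
  {A : ∀ i, EuclideanSpace ℝ (Fin (n i)) →ₗ[ℝ] Minkowski (N + 1)}

theorem exists_isLightConeFrame (hN : ∑ i, n i = N) (ho : o ≠ 0) (hoo : lorentz o o = 0)
    (hA : ∀ i u v, lorentz (A i u) (A i v) = inner ℝ u v)
    (hA' : ∀ i j, i ≠ j → ∀ u v, lorentz (A i u) (A j v) = 0)
    (hAo : ∀ i u, lorentz (A i u) o = 0) : ∃ ξ, IsLightConeFrame o ξ A := by
  obtain ⟨ι⟩ := exists_isometry_piLp hN
  obtain ⟨T, rfl, hTA⟩ := LightConeTriple.exists_extension ho hoo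
    (sumFrame A ∘ₗ ι.toLinearEquiv.toLinearMap)
    (fun x y => (lorentz_sumFrame hA hA' _ _).trans (ι.inner_map_map x y))
    (fun x => lorentz_sumFrame_eq_zero hAo _)
  refine ⟨T.w, hN, hoo, T.lorentz_w_w, T.lorentz_p₀_w, hA, hA', hAo, fun i u => ?_⟩
  have hAw := T.lorentz_A_w (ι.symm (WithLp.toLp 2 (Pi.single i u)))
  rw [hTA] at hAw
  change lorentz (sumFrame A (ι (ι.symm _))) T.w = 0 at hAw
  rwa [ι.apply_symm_apply, sumFrame_single] at hAw

namespace IsLightConeFrame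
variable (h : IsLightConeFrame o ξ A)
include h

theorem exists_decomp (z : Minkowski (N + 1)) :
    ∃ (a b : ℝ) (x : PiLp 2 fun i => EuclideanSpace ℝ (Fin (n i))),
      z = a • o + b • ξ + sumFrame A x := by
  obtain ⟨ι⟩ := exists_isometry_piLp h.dim
  let T : LightConeTriple N :=
    { p₀ := o
      w := ξ
      A := sumFrame A ∘ₗ ι.toLinearEquiv.toLinearMap
      lorentz_w_w := h.lorentz_ξ_ξ
      lorentz_p₀_p₀ := h.lorentz_o_o
      lorentz_p₀_w := h.lorentz_o_ξ
      lorentz_A := fun x y =>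
        (lorentz_sumFrame h.lorentz_A h.lorentz_A_of_ne _ _).trans (ι.inner_map_map x y)
      lorentz_A_p₀ := fun x => lorentz_sumFrame_eq_zero h.lorentz_A_o _
      lorentz_A_w := fun x => lorentz_sumFrame_eq_zero h.lorentz_A_ξ _ }
  obtain ⟨a, b, x, hz⟩ := T.exists_decomp z
  exact ⟨a, b, ι x, hz⟩

theorem eq_add_sum_lorentzAdjoint (z : Minkowski (N + 1)) :
    z = lorentz z ξ • o + lorentz z o • ξ + ∑ i, A i (lorentzAdjoint (A i) z) := by
  obtain ⟨a, b, x, rfl⟩ := h.exists_decomp z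
  have hadj : ∀ i, lorentzAdjoint (A i) (a • o + b • ξ + sumFrame A x) = x i := fun i =>
    ext_inner_right ℝ fun v => by
      rw [inner_lorentzAdjoint, lorentz_add_left, lorentz_add_left, lorentz_smul_left,
        lorentz_smul_left, lorentz_comm o, h.lorentz_A_o, lorentz_comm ξ, h.lorentz_A_ξ,
        lorentz_sumFrame_left h.lorentz_A h.lorentz_A_of_ne, mul_zero, mul_zero, zero_add,
        zero_add]
  simp only [hadj]
  simp only [lorentz_add_left, lorentz_smul_left, lorentz_sumFrame_eq_zero h.lorentz_A_o,
    lorentz_sumFrame_eq_zero h.lorentz_A_ξ, h.lorentz_o_o, h.lorentz_ξ_ξ, h.lorentz_o_ξ,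
    lorentz_comm ξ o, mul_zero, mul_one, add_zero, zero_add, ← sumFrame_apply]

end IsLightConeFrame
end Frame

/-! ### Splittings -/

section NullSums
variable {k N : ℕ} {M : Fin k → Type*} {o : Minkowski N} {G : ∀ i, M i → Minkowski N}
  {p₀ : ∀ i, M i}
  (hnull : ∀ p : ∀ i, M i, lorentz (o + ∑ i, G i (p i)) (o + ∑ i, G i (p i)) = 0)
  (hG₀ : ∀ i, G i (p₀ i) = 0)
include hnull hG₀

theorem lorentz_self_eq_zero_of_sum_null : lorentz o o = 0 := by
  simpa [hG₀] using hnull p₀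

theorem two_mul_lorentz_add_lorentz_self_of_sum_null (i : Fin k) (x : M i) :
    2 * lorentz o (G i x) + lorentz (G i x) (G i x) = 0 := by
  have hsum : ∑ l, G l (Function.update p₀ i x l) = G i x := by
    rw [Finset.sum_eq_single i (fun l _ hl => by simp [hl, hG₀]) (by simp),
      Function.update_self]
  have hx := hnull (Function.update p₀ i x)
  rw [hsum] at hx
  simp only [lorentz_add_left, lorentz_add_right, lorentz_self_eq_zero_of_sum_null hnull hG₀,
    lorentz_comm (G i x) o] at hx
  linarith

theorem lorentz_eq_zero_of_sum_null (i j : Fin k) (hij : i ≠ j) (x : M i) (y : M j) :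
    lorentz (G i x) (G j y) = 0 := by
  have hsum : ∑ l, G l (Function.update (Function.update p₀ i x) j y l) = G i x + G j y := by
    rw [← Finset.sum_subset (Finset.subset_univ {i, j}), Finset.sum_pair hij]
    · simp [hij]
    · intro l _ hl
      simp only [Finset.mem_insert, Finset.mem_singleton, not_or] at hl
      simp [hl.1, hl.2, hG₀]
  have hxy := hnull (Function.update (Function.update p₀ i x) j y)
  rw [hsum] at hxy
  simp only [lorentz_add_left, lorentz_add_right, lorentz_self_eq_zero_of_sum_null hnull hG₀,
    lorentz_comm (G i x) o, lorentz_comm (G j y) o, lorentz_comm (G j y) (G i x)] at hxy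
  linarith [two_mul_lorentz_add_lorentz_self_of_sum_null hnull hG₀ i x,
    two_mul_lorentz_add_lorentz_self_of_sum_null hnull hG₀ j y]

end NullSums

section lorentzMvfderiv
variable {N : ℕ} {E H X : Type*} [NormedAddCommGroup E] [NormedSpace ℝ E] [TopologicalSpace H]
  {I : ModelWithCorners ℝ E H} [TopologicalSpace X] [ChartedSpace H X] {G : X → Minkowski N}
  {x : X}

theorem lorentz_mvfderiv_eq_zero {z : Minkowski N}
    (hG : MDifferentiableAt I 𝓘(ℝ, Minkowski N) G x) (hz : ∀ y, lorentz (G y) z = 0)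
    (u : TangentSpace I x) : lorentz (mvfderiv I G x u) z = 0 :=
  apply_mvfderiv_eq_zero_of_const hG ((lorentzL N).flip z).hasFDerivAt hz u

theorem lorentz_mvfderiv_eq_zero_of_two_mul_add {o : Minkowski N}
    (hG : MDifferentiableAt I 𝓘(ℝ, Minkowski N) G x) (hx : G x = 0)
    (ho : ∀ y, 2 * lorentz o (G y) + lorentz (G y) (G y) = 0) (u : TangentSpace I x) :
    lorentz (mvfderiv I G x u) o = 0 := by
  have hq : HasFDerivAt (fun z => 2 * lorentzL N o z + lorentzL N z z) _ (G x) :=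
    ((lorentzL N o).hasFDerivAt.const_mul 2).add
      ((lorentzL N).hasFDerivAt.clm_apply (hasFDerivAt_id (G x)))
  have hzero := apply_mvfderiv_eq_zero_of_const hG hq ho u
  rw [hx] at hzero
  rw [lorentz_comm]
  simpa using hzero

end lorentzMvfderiv

section Splitting
variable {k : ℕ} {n : Fin k → ℕ} {M : Fin k → Type*} [∀ i, TopologicalSpace (M i)]
  [∀ i, ChartedSpace (EuclideanSpace ℝ (Fin (n i))) (M i)]
  [∀ i, IsManifold (𝓡 (n i)) ∞ (M i)] {N : ℕ}

/-- Maps `G i` of Riemannian manifolds into `𝕃^(N+2)` such that `p ↦ o + ∑ i, G i (p i)` is an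
isometric immersion of the product into the light cone, with orthonormal frames `A i` of the
tangent spaces at some point, where the sum is `o`, and a light-like vector `ξ` which is normal at
this point. -/
structure IsLightConeSplitting (g : ∀ i, RiemMetric (n i) (M i)) (o ξ : Minkowski (N + 1))
    (G : ∀ i, M i → Minkowski (N + 1))
    (A : ∀ i, EuclideanSpace ℝ (Fin (n i)) →ₗ[ℝ] Minkowski (N + 1)) : Prop
    extends IsLightConeFrame o ξ A where
  lorentz_G_of_ne : ∀ i j, i ≠ j → ∀ x y, lorentz (G i x) (G j y) = 0
  lorentz_G_self : ∀ i x, 2 * lorentz o (G i x) + lorentz (G i x) (G i x) = 0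
  contMDiff : ∀ i, ContMDiff (𝓡 (n i)) 𝓘(ℝ, Minkowski (N + 1)) ∞ (G i)
  isometric : ∀ i (x : M i) (u v : TangentSpace (𝓡 (n i)) x),
    lorentz (mvfderiv (𝓡 (n i)) (G i) x u) (mvfderiv (𝓡 (n i)) (G i) x v) = (g i).inner x u v
  exists_eq_zero : ∀ i, ∃ x, G i x = 0
  exists_mvfderiv_eq : ∀ i u, ∃ (x : M i) (v : TangentSpace (𝓡 (n i)) x),
    mvfderiv (𝓡 (n i)) (G i) x v = A i u

theorem exists_isLightConeSplitting (hN : ∑ i, n i = N) {g : ∀ i, RiemMetric (n i) (M i)}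
    {o : Minkowski (N + 1)} (ho : o ≠ 0) {G : ∀ i, M i → Minkowski (N + 1)} {p₀ : ∀ i, M i}
    (hnull : ∀ p : ∀ i, M i, lorentz (o + ∑ i, G i (p i)) (o + ∑ i, G i (p i)) = 0)
    (hG₀ : ∀ i, G i (p₀ i) = 0)
    (hG : ∀ i, ContMDiff (𝓡 (n i)) 𝓘(ℝ, Minkowski (N + 1)) ∞ (G i))
    (hiso : ∀ i (x : M i) (u v : TangentSpace (𝓡 (n i)) x),
      lorentz (mvfderiv (𝓡 (n i)) (G i) x u) (mvfderiv (𝓡 (n i)) (G i) x v)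
        = (g i).inner x u v) : ∃ ξ A, IsLightConeSplitting g o ξ G A := by
  have hdiff : ∀ i x, MDifferentiableAt (𝓡 (n i)) 𝓘(ℝ, Minkowski (N + 1)) (G i) x := fun i x =>
    (hG i).mdifferentiableAt (by simp)
  have hGG := lorentz_eq_zero_of_sum_null hnull hG₀
  have hGself := two_mul_lorentz_add_lorentz_self_of_sum_null hnull hG₀
  choose e he using fun i => exists_orthonormal_frame_tangentSpace (g i) (p₀ i)
  let A : ∀ i, EuclideanSpace ℝ (Fin (n i)) →ₗ[ℝ] Minkowski (N + 1) := fun i =>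
    (mvfderiv (𝓡 (n i)) (G i) (p₀ i)).toLinearMap ∘ₗ (e i).toLinearMap
  have hAG : ∀ i j, i ≠ j → ∀ u y, lorentz (A i u) (G j y) = 0 := fun i j hij u y =>
    lorentz_mvfderiv_eq_zero (hdiff i _) (fun x => hGG i j hij x y) (e i u)
  obtain ⟨ξ, hframe⟩ := exists_isLightConeFrame (A := A) hN ho
    (lorentz_self_eq_zero_of_sum_null hnull hG₀)
    (fun i u v => (hiso i (p₀ i) (e i u) (e i v)).trans (he i u v))
    (fun i j hij u v => (lorentz_comm _ _).trans <| lorentz_mvfderiv_eq_zero (hdiff j _)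
      (fun y => (lorentz_comm _ _).trans (hAG i j hij u y)) (e j v))
    (fun i u => lorentz_mvfderiv_eq_zero_of_two_mul_add (hdiff i _) (hG₀ i) (hGself i) (e i u))
  exact ⟨ξ, A, { toIsLightConeFrame := hframe
                 lorentz_G_of_ne := hGG
                 lorentz_G_self := hGself
                 contMDiff := hG
                 isometric := hiso
                 exists_eq_zero := fun i => ⟨_, hG₀ i⟩
                 exists_mvfderiv_eq := fun i u => ⟨_, e i u, rfl⟩ }⟩

end Splitting

section Dichotomy
variable {k : ℕ} {n : Fin k → ℕ} {N : ℕ} {o ξ : Minkowski (N + 1)}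
  {A : ∀ i, EuclideanSpace ℝ (Fin (n i)) →ₗ[ℝ] Minkowski (N + 1)}

namespace IsLightConeFrame
variable (h : IsLightConeFrame o ξ A)
include h

theorem eq_add_lorentzAdjoint_of_orthogonal {i : Fin k} {z : Minkowski (N + 1)}
    (hz : ∀ j ≠ i, ∀ u, lorentz (A j u) z = 0) :
    z = lorentz z ξ • o + lorentz z o • ξ + A i (lorentzAdjoint (A i) z) := by
  conv_lhs => rw [h.eq_add_sum_lorentzAdjoint z]
  rw [Finset.sum_eq_single i]
  · intro j _ hj
    have hadj : lorentzAdjoint (A j) z = 0 := ext_inner_right ℝ fun u => by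
      rw [inner_lorentzAdjoint, lorentz_comm, hz j hj, inner_zero_left]
    rw [hadj, map_zero]
  · simp

theorem inner_lorentzAdjoint_of_orthogonal {i : Fin k} {y z : Minkowski (N + 1)}
    (hy : lorentz y ξ = 0) (hzξ : lorentz z ξ = 0) (hz : ∀ j ≠ i, ∀ u, lorentz (A j u) z = 0) :
    inner ℝ (lorentzAdjoint (A i) y) (lorentzAdjoint (A i) z) = lorentz y z := by
  conv_rhs => rw [h.eq_add_lorentzAdjoint_of_orthogonal hz]
  rw [inner_lorentzAdjoint, hzξ, zero_smul, zero_add, lorentz_add_right, lorentz_smul_right, hy,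
    mul_zero, zero_add]

end IsLightConeFrame

theorem forall_eq_zero_or_exists_pair_of_eq_neg {ι : Type*} [Nontrivial ι] {μ : ι → ℝ}
    (hμ : ∀ i j, i ≠ j → μ i = -μ j) :
    (∀ i, μ i = 0) ∨ ∃ i j, i ≠ j ∧ (∀ l, l = i ∨ l = j) ∧ 0 < μ j := by
  refine or_iff_not_imp_left.2 fun hne => ?_
  push Not at hne
  obtain ⟨i, hi⟩ := hne
  obtain ⟨j, hji⟩ := exists_ne i
  have hij := hμ j i hji
  have hall : ∀ l, l = i ∨ l = j := by
    intro l
    by_contra! hl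
    exact hi (by linarith [hμ l i hl.1, hμ l j hl.2])
  rcases hi.lt_or_gt with hneg | hpos
  · exact ⟨i, j, hji.symm, hall, by linarith⟩
  · exact ⟨j, i, hji, fun l => (hall l).symm, hpos⟩

variable {M : Fin k → Type*} [∀ i, TopologicalSpace (M i)]
  [∀ i, ChartedSpace (EuclideanSpace ℝ (Fin (n i))) (M i)] [∀ i, IsManifold (𝓡 (n i)) ∞ (M i)]
  {g : ∀ i, RiemMetric (n i) (M i)} {G : ∀ i, M i → Minkowski (N + 1)}

namespace IsLightConeSplitting
variable (h : IsLightConeSplitting g o ξ G A)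
include h

theorem mdifferentiableAt (i : Fin k) (x : M i) :
    MDifferentiableAt (𝓡 (n i)) 𝓘(ℝ, Minkowski (N + 1)) (G i) x :=
  (h.contMDiff i).mdifferentiableAt (by simp)

theorem nonempty_pi : Nonempty (∀ i, M i) :=
  ⟨fun i => (h.exists_eq_zero i).choose⟩

theorem lorentz_A_G {i j : Fin k} (hij : i ≠ j) (u : EuclideanSpace ℝ (Fin (n i))) (y : M j) :
    lorentz (A i u) (G j y) = 0 := by
  obtain ⟨x, v, hv⟩ := h.exists_mvfderiv_eq i u
  rw [← hv]
  exact lorentz_mvfderiv_eq_zero (h.mdifferentiableAt i x)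
    (fun x => h.lorentz_G_of_ne i j hij x y) v

theorem G_eq (i : Fin k) (x : M i) :
    G i x = lorentz (G i x) ξ • o + lorentz (G i x) o • ξ + A i (lorentzAdjoint (A i) (G i x)) :=
  h.eq_add_lorentzAdjoint_of_orthogonal fun _ hj u => h.lorentz_A_G hj u x

theorem lorentz_A_mvfderiv {i j : Fin k} (hij : i ≠ j) (u : EuclideanSpace ℝ (Fin (n i))) {y : M j}
    (v : TangentSpace (𝓡 (n j)) y) : lorentz (A i u) (mvfderiv (𝓡 (n j)) (G j) y v) = 0 := by
  rw [lorentz_comm]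
  exact lorentz_mvfderiv_eq_zero (h.mdifferentiableAt j y)
    (fun y => (lorentz_comm _ _).trans (h.lorentz_A_G hij u y)) v

theorem mul_add_mul_eq_zero {i j : Fin k} (hij : i ≠ j) (x : M i) (y : M j) :
    lorentz (G i x) ξ * lorentz (G j y) o + lorentz (G i x) o * lorentz (G j y) ξ = 0 := by
  have hGG := h.lorentz_G_of_ne i j hij x y
  rwa [h.G_eq i x, lorentz_add_left, lorentz_add_left, lorentz_smul_left, lorentz_smul_left,
    h.lorentz_A_G hij, add_zero, lorentz_comm o, lorentz_comm ξ] at hGG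

theorem lorentzAdjoint_G_eq_zero {i : Fin k} {x : M i} (hx : lorentz (G i x) o = 0) :
    lorentzAdjoint (A i) (G i x) = 0 := by
  have hself := h.lorentz_G_self i x
  rw [lorentz_comm o, hx, mul_zero, zero_add, h.G_eq i x, hx, zero_smul, add_zero] at hself
  simpa [lorentz_add_left, lorentz_add_right, lorentz_smul_left, lorentz_smul_right,
    h.lorentz_o_o, h.lorentz_A_o, lorentz_comm o (A i _), h.lorentz_A] using hself

theorem exists_lorentz_o_ne_zero {i : Fin k} (hn : 1 ≤ n i) : ∃ x, lorentz (G i x) o ≠ 0 := by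
  by_contra! hzero
  have : Nonempty (Fin (n i)) := ⟨⟨0, hn⟩⟩
  obtain ⟨u, hu⟩ := exists_ne (0 : EuclideanSpace ℝ (Fin (n i)))
  obtain ⟨x, v, hv⟩ := h.exists_mvfderiv_eq i u
  have hadj := apply_mvfderiv_eq_zero_of_const (h.mdifferentiableAt i x)
    (lorentzAdjoint (A i)).hasFDerivAt (fun x => h.lorentzAdjoint_G_eq_zero (hzero x)) v
  have hinner := inner_lorentzAdjoint (A i) (A i u) u
  rw [← hv, hadj, hv, inner_zero_left, h.lorentz_A] at hinner
  exact hu (inner_self_eq_zero.1 hinner.symm)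

theorem exists_slope (hk : 2 ≤ k) (hn : ∀ i, 1 ≤ n i) :
    ∃ μ : Fin k → ℝ, (∀ i x, lorentz (G i x) ξ = μ i * lorentz (G i x) o) ∧
      ∀ i j, i ≠ j → μ i = -μ j := by
  choose y hy using fun i => h.exists_lorentz_o_ne_zero (hn i)
  let μ : Fin k → ℝ := fun i => lorentz (G i (y i)) ξ / lorentz (G i (y i)) o
  have hy_mul : ∀ i, lorentz (G i (y i)) ξ = μ i * lorentz (G i (y i)) o := fun i =>
    (div_mul_cancel₀ _ (hy i)).symm
  have hneg_mul : ∀ i j, i ≠ j → ∀ x, lorentz (G i x) ξ = -μ j * lorentz (G i x) o := by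
    intro i j hij x
    have hmul := h.mul_add_mul_eq_zero hij x (y j)
    rw [hy_mul] at hmul
    exact mul_right_cancel₀ (hy j) (by linarith)
  have hμ : ∀ i j, i ≠ j → μ i = -μ j := fun i j hij =>
    mul_right_cancel₀ (hy i) ((hy_mul i).symm.trans (hneg_mul i j hij (y i)))
  have : Nontrivial (Fin k) := Fin.nontrivial_iff_two_le.2 hk
  refine ⟨μ, fun i x => ?_, hμ⟩
  obtain ⟨j, hj⟩ := exists_ne i
  rw [hneg_mul i j hj.symm, ← hμ i j hj.symm]

theorem lorentz_ξ_eq_zero_or_exists_pair (hk : 2 ≤ k) (hn : ∀ i, 1 ≤ n i) :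
    (∀ i x, lorentz (G i x) ξ = 0) ∨
    ∃ i j : Fin k, i ≠ j ∧ (∀ l, l = i ∨ l = j) ∧ ∃ μ : ℝ, 0 < μ ∧
      (∀ x, lorentz (G i x) ξ = -μ * lorentz (G i x) o) ∧
      ∀ y, lorentz (G j y) ξ = μ * lorentz (G j y) o := by
  obtain ⟨μ, hμG, hμ⟩ := h.exists_slope hk hn
  have : Nontrivial (Fin k) := Fin.nontrivial_iff_two_le.2 hk
  rcases forall_eq_zero_or_exists_pair_of_eq_neg hμ with hzero | ⟨i, j, hij, hall, hpos⟩
  · exact Or.inl fun i x => by rw [hμG, hzero, zero_mul]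
  · exact Or.inr ⟨i, j, hij, hall, μ j, hpos, fun x => by rw [hμG, hμ i j hij], hμG j⟩

/-! ### The Euclidean form -/

section Euclidean
variable (hξ : ∀ i x, lorentz (G i x) ξ = 0)
include hξ

theorem isLocalIsometryEuclidean_lorentzAdjoint (i : Fin k) :
    IsLocalIsometryEuclidean (g i) fun x => lorentzAdjoint (A i) (G i x) := by
  refine isLocalIsometryEuclidean_of_isometric (g i)
    ((lorentzAdjoint (A i)).contDiff.contMDiff.comp (h.contMDiff i)) fun x u v => ?_
  have hdiff := h.mdifferentiableAt i x
  have hadj := (lorentzAdjoint (A i)).hasFDerivAt (x := G i x)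
  rw [mvfderiv_comp_of_hasFDerivAt hdiff hadj, mvfderiv_comp_of_hasFDerivAt hdiff hadj,
    ← h.isometric]
  exact h.inner_lorentzAdjoint_of_orthogonal (lorentz_mvfderiv_eq_zero hdiff (hξ i) u)
    (lorentz_mvfderiv_eq_zero hdiff (hξ i) v) fun j hj w => h.lorentz_A_mvfderiv hj w v

theorem exists_isometryEquiv (T : LightConeTriple N) {β : ℝ} (hβ : β ≠ 0) (hT : ξ = β • T.w)
    (b : EuclideanSpace ℝ (Fin N)) :
    ∃ Φ : PiLp 2 (fun i => EuclideanSpace ℝ (Fin (n i))) ≃ᵢ EuclideanSpace ℝ (Fin N),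
      ∀ p : ∀ i, M i, Φ (WithLp.toLp 2 fun i => lorentzAdjoint (A i) (G i (p i)))
        = b + lorentzAdjoint T.A (o + ∑ i, G i (p i)) := by
  have hAw : ∀ i u, lorentz (A i u) T.w = 0 := fun i u => by
    have hAξ := h.lorentz_A_ξ i u
    rw [hT, lorentz_smul_right] at hAξ
    exact (mul_eq_zero.1 hAξ).resolve_left hβ
  have hadjξ : lorentzAdjoint T.A ξ = 0 := ext_inner_right ℝ fun v => by
    rw [inner_lorentzAdjoint, hT, lorentz_smul_left, T.lorentz_w_A, mul_zero, inner_zero_left]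
  let L := (lorentzAdjoint T.A).toLinearMap ∘ₗ sumFrame A
  have hL : ∀ x y, inner ℝ (L x) (L y) = inner ℝ x y := fun x y =>
    (T.inner_lorentzAdjoint_lorentzAdjoint (lorentz_sumFrame_eq_zero hAw x)
      (lorentz_sumFrame_eq_zero hAw y)).trans (lorentz_sumFrame h.lorentz_A h.lorentz_A_of_ne x y)
  obtain ⟨ι⟩ := exists_isometry_piLp h.dim
  let Q := (L.isometryOfInner hL).toLinearIsometryEquiv ι.toLinearEquiv.finrank_eq.symm
  refine ⟨Q.toIsometryEquiv.trans (IsometryEquiv.addLeft (b + lorentzAdjoint T.A o)),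
    fun p => ?_⟩
  change b + lorentzAdjoint T.A o + lorentzAdjoint T.A (sumFrame A _) = _
  rw [sumFrame_apply, map_add, add_assoc, map_sum, map_sum]
  congr 2
  refine Finset.sum_congr rfl fun i _ => ?_
  conv_rhs => rw [h.G_eq i (p i)]
  rw [hξ, zero_smul, zero_add, map_add, map_smul, hadjξ, smul_zero, zero_add]

end Euclidean
end IsLightConeSplitting

namespace LightConeTriple
variable (T : LightConeTriple N)

theorem exists_eq_smul_w {z : Minkowski (N + 1)} (hz : lorentz z z = 0) (hw : lorentz z T.w = 0) :
    ∃ β : ℝ, z = β • T.w := by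
  have hadj : lorentzAdjoint T.A z = 0 :=
    inner_self_eq_zero.1 ((T.inner_lorentzAdjoint_lorentzAdjoint hw hw).trans hz)
  refine ⟨lorentz z T.p₀, ?_⟩
  conv_lhs => rw [T.eq_smul_w_add_A_lorentzAdjoint hw, hadj, map_zero, add_zero]

/-- The triple obtained by interchanging the roles of the points `b` and `∞`; passing to it is an
inversion of `ℝ^N` with centre `b` followed by a translation. -/
def swap (b : EuclideanSpace ℝ (Fin N)) : LightConeTriple N where
  p₀ := T.w
  w := T.embed b
  A := T.A - (innerₛₗ ℝ b).smulRight T.w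
  lorentz_w_w := T.lorentz_embed_self b
  lorentz_p₀_p₀ := T.lorentz_w_w
  lorentz_p₀_w := by rw [lorentz_comm, T.lorentz_embed_w]
  lorentz_A := fun x y => by
    simp [lorentz_sub_left, lorentz_sub_right, lorentz_smul_left, lorentz_smul_right,
      T.lorentz_A, T.lorentz_A_w, T.lorentz_w_A, T.lorentz_w_w]
  lorentz_A_p₀ := fun x => by
    simp [lorentz_sub_left, lorentz_smul_left, T.lorentz_A_w, T.lorentz_w_w]
  lorentz_A_w := fun x => by
    simp [lorentz_sub_left, lorentz_smul_left, lorentz_comm (T.A x), lorentz_comm T.w,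
      T.lorentz_embed_A, T.lorentz_embed_w]

theorem lorentzAdjoint_swap_embed (b x : EuclideanSpace ℝ (Fin N)) :
    lorentzAdjoint (T.swap b).A (T.embed x) = x - b :=
  ext_inner_right ℝ fun v => by
    rw [inner_lorentzAdjoint, inner_sub_left]
    change lorentz (T.embed x) (T.A v - (inner ℝ b v : ℝ) • T.w) = _
    rw [lorentz_sub_right, lorentz_smul_right, T.lorentz_embed_A, T.lorentz_embed_w, mul_one]

end LightConeTriple

/-- The first form of a map of a Riemannian product into `ℝ^N`: a product of local isometries
followed by an isometry, a homothety and possibly an inversion. -/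
def HasSimilarityForm (g : ∀ i, RiemMetric (n i) (M i))
    (f : (∀ i, M i) → EuclideanSpace ℝ (Fin N)) : Prop :=
  ∃ (Φ : PiLp 2 (fun i => EuclideanSpace ℝ (Fin (n i))) ≃ᵢ EuclideanSpace ℝ (Fin N))
      (F : ∀ i, M i → EuclideanSpace ℝ (Fin (n i)))
      (H : EuclideanSpace ℝ (Fin N) → EuclideanSpace ℝ (Fin N)),
    (∀ i, IsLocalIsometryEuclidean (g i) (F i)) ∧
    (∃ (a : EuclideanSpace ℝ (Fin N)) (r : ℝ), 0 < r ∧ H = AffineMap.homothety a r) ∧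
    ((∀ p, f p = H (Φ (WithLp.toLp 2 fun i => F i (p i)))) ∨
      ∃ (b : EuclideanSpace ℝ (Fin N)) (s : ℝ), 0 < s ∧
        ∀ p, H (Φ (WithLp.toLp 2 fun i => F i (p i))) ≠ b ∧
          f p = EuclideanGeometry.inversion b s (H (Φ (WithLp.toLp 2 fun i => F i (p i)))))

namespace IsLightConeSplitting
variable (h : IsLightConeSplitting g o ξ G A) (hξ : ∀ i x, lorentz (G i x) ξ = 0)
  (T : LightConeTriple N) {f : (∀ i, M i) → EuclideanSpace ℝ (Fin N)} {ρ : (∀ i, M i) → ℝ}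
  (hf : ∀ p, ρ p • T.embed (f p) = o + ∑ i, G i (p i))
include h hξ hf

theorem mul_lorentz_embed_ξ (p : ∀ i, M i) : ρ p * lorentz (T.embed (f p)) ξ = 1 := by
  rw [← lorentz_smul_left, hf, lorentz_add_left, h.lorentz_o_ξ, lorentz_sum_left,
    Finset.sum_eq_zero fun i _ => hξ i _, add_zero]

variable (hρ : ∀ p, 0 < ρ p)
include hρ

theorem exists_homothety_form (hw : lorentz ξ T.w = 0) :
    ∃ (Φ : PiLp 2 (fun i => EuclideanSpace ℝ (Fin (n i))) ≃ᵢ EuclideanSpace ℝ (Fin N)) (β : ℝ),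
      0 < β ∧
      ∀ p, f p = β • Φ (WithLp.toLp 2 fun i => lorentzAdjoint (A i) (G i (p i))) := by
  obtain ⟨β, hβ⟩ := T.exists_eq_smul_w h.lorentz_ξ_ξ hw
  have hρβ : ∀ p, ρ p * β = 1 := fun p => by
    have hone := h.mul_lorentz_embed_ξ hξ T hf p
    rwa [hβ, lorentz_smul_right, T.lorentz_embed_w, mul_one] at hone
  obtain ⟨p⟩ := h.nonempty_pi
  have hβpos : 0 < β := pos_of_mul_pos_right (by rw [hρβ p]; exact one_pos) (hρ p).le
  obtain ⟨Φ, hΦ⟩ := h.exists_isometryEquiv hξ T hβpos.ne' hβ 0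
  refine ⟨Φ, β, hβpos, fun p => ?_⟩
  rw [hΦ, zero_add, ← hf, map_smul, T.lorentzAdjoint_embed, smul_smul, mul_comm, hρβ, one_smul]

theorem exists_inversion_form (hw : lorentz ξ T.w ≠ 0) :
    ∃ (Φ : PiLp 2 (fun i => EuclideanSpace ℝ (Fin (n i))) ≃ᵢ EuclideanSpace ℝ (Fin N))
      (b : EuclideanSpace ℝ (Fin N)) (s : ℝ), 0 < s ∧ ∀ p, f p ≠ b ∧
        Φ (WithLp.toLp 2 fun i => lorentzAdjoint (A i) (G i (p i)))
          = EuclideanGeometry.inversion b s (f p) := by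
  set α := lorentz ξ T.w
  set b := T.toEuclidean ξ
  have hξb : ξ = α • T.embed b := by
    rw [T.embed_toEuclidean h.lorentz_ξ_ξ hw, smul_smul, mul_inv_cancel₀ hw, one_smul]
  have hdist : ∀ p, ρ p * (-α * ‖f p - b‖ ^ 2) = 2 := fun p => by
    have hone := h.mul_lorentz_embed_ξ hξ T hf p
    rw [hξb, lorentz_smul_right, T.lorentz_embed_embed] at hone
    linarith
  have hne : ∀ p, f p ≠ b := fun p hp => by simpa [hp] using hdist p
  have hα : 0 < -α := by
    obtain ⟨p⟩ := h.nonempty_pi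
    exact pos_of_mul_pos_left (pos_of_mul_pos_right (by rw [hdist]; exact two_pos) (hρ p).le)
      (sq_nonneg _)
  obtain ⟨Φ, hΦ⟩ := h.exists_isometryEquiv hξ (T.swap b) hw hξb b
  refine ⟨Φ, b, √(2 / -α), Real.sqrt_pos.2 (div_pos two_pos hα), fun p => ⟨hne p, ?_⟩⟩
  rw [hΦ, ← hf, map_smul, T.lorentzAdjoint_swap_embed, EuclideanGeometry.inversion, div_pow,
    Real.sq_sqrt (div_pos two_pos hα).le, dist_eq_norm, vsub_eq_sub, vadd_eq_add, add_comm]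
  congr 2
  have hnorm : ‖f p - b‖ ≠ 0 := norm_ne_zero_iff.2 (sub_ne_zero.2 (hne p))
  rw [div_div, eq_div_iff (mul_ne_zero hα.ne' (pow_ne_zero 2 hnorm)), hdist]

theorem hasSimilarityForm : HasSimilarityForm g f := by
  have hiso := h.isLocalIsometryEuclidean_lorentzAdjoint hξ
  by_cases hw : lorentz ξ T.w = 0
  · obtain ⟨Φ, β, hβ, hΦ⟩ := h.exists_homothety_form hξ T hf hρ hw
    exact ⟨Φ, _, _, hiso, ⟨0, β, hβ, rfl⟩, Or.inl fun p => by
      simp [AffineMap.homothety_apply, hΦ p]⟩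
  · obtain ⟨Φ, b, s, hs, hΦ⟩ := h.exists_inversion_form hξ T hf hρ hw
    refine ⟨Φ, _, _, hiso, ⟨0, 1, one_pos, rfl⟩, Or.inr ⟨b, s, hs, fun p => ?_⟩⟩
    rw [AffineMap.homothety_one, AffineMap.id_apply, (hΦ p).2]
    exact ⟨fun hb => (hΦ p).1 ((EuclideanGeometry.inversion_eq_center hs.ne').1 hb),
      (EuclideanGeometry.inversion_inversion b hs.ne' (f p)).symm⟩

end IsLightConeSplitting

end Dichotomy

/-! ### The form `Θ ∘ (f₁ × f₂)` -/

namespace LorentzSplitting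
variable {N m n : ℕ} (S : LorentzSplitting N m n)

/-- The identification of `𝕃^(m+1) × ℝ^(n+1)` with `𝕃^(N+2)` given by the orthogonal
decomposition. -/
def equiv : (Minkowski m × EuclideanSpace ℝ (Fin (n + 1))) ≃L[ℝ] Minkowski (N + 1) :=
  (LinearEquiv.ofBijective (S.C.coprod S.D) ⟨S.injective, S.surjective⟩).toContinuousLinearEquiv

/-- The component in `𝕃^(m+1)` of a vector of `𝕃^(N+2)`. -/
def projC : Minkowski (N + 1) →L[ℝ] Minkowski m :=
  (ContinuousLinearMap.fst ℝ (Minkowski m) (EuclideanSpace ℝ (Fin (n + 1)))).comp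
    S.equiv.symm.toContinuousLinearMap

/-- The component in `ℝ^(n+1)` of a vector of `𝕃^(N+2)`. -/
def projD : Minkowski (N + 1) →L[ℝ] EuclideanSpace ℝ (Fin (n + 1)) :=
  (ContinuousLinearMap.snd ℝ (Minkowski m) (EuclideanSpace ℝ (Fin (n + 1)))).comp
    S.equiv.symm.toContinuousLinearMap

theorem C_projC_add_D_projD (z : Minkowski (N + 1)) : S.C (S.projC z) + S.D (S.projD z) = z :=
  S.equiv.apply_symm_apply z

theorem lorentz_projC (z : Minkowski (N + 1)) (X : Minkowski m) :
    lorentz (S.projC z) X = lorentz z (S.C X) := by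
  conv_rhs => rw [← S.C_projC_add_D_projD z]
  rw [lorentz_add_left, S.lorentz_C, lorentz_comm (S.D _), S.lorentz_C_D, add_zero]

theorem inner_projD (z : Minkowski (N + 1)) (Y : EuclideanSpace ℝ (Fin (n + 1))) :
    inner ℝ (S.projD z) Y = lorentz z (S.D Y) := by
  conv_rhs => rw [← S.C_projC_add_D_projD z]
  rw [lorentz_add_left, S.lorentz_D, S.lorentz_C_D, zero_add]

theorem lorentz_projC_add_inner_projD (y z : Minkowski (N + 1)) :
    lorentz (S.projC y) (S.projC z) + inner ℝ (S.projD y) (S.projD z) = lorentz y z := by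
  rw [← S.lorentz_C_add_D, C_projC_add_D_projD, C_projC_add_D_projD]

theorem projC_eq_zero {z : Minkowski (N + 1)} (hz : ∀ X, lorentz z (S.C X) = 0) :
    S.projC z = 0 := by
  have hself := hz (timeReversal (S.projC z))
  rw [← S.lorentz_projC, lorentz_comm, lorentz_timeReversal] at hself
  exact inner_self_eq_zero.1 hself

theorem projD_eq_zero {z : Minkowski (N + 1)} (hz : ∀ Y, lorentz z (S.D Y) = 0) :
    S.projD z = 0 :=
  inner_self_eq_zero.1 ((S.inner_projD z _).trans (hz _))

end LorentzSplitting

/-- The orthogonal projection of `ℝ^(m+1)` onto the subspace `ℝ^m` of the first `m` coordinates. -/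
def initCoords (m : ℕ) : EuclideanSpace ℝ (Fin (m + 1)) →ₗ[ℝ] EuclideanSpace ℝ (Fin m) where
  toFun x := WithLp.toLp 2 fun i => x i.castSucc
  map_add' x y := by ext i; simp
  map_smul' r x := by ext i; simp

theorem inner_initCoords {m : ℕ} (x y : EuclideanSpace ℝ (Fin (m + 1))) :
    inner ℝ (initCoords m x) (initCoords m y) = ∑ i : Fin m, x i.castSucc * y i.castSucc := by
  simp [initCoords, PiLp.inner_apply, mul_comm]

/-- The linear map on `ℝ^(m+1)` which extends `A` by sending the last basis vector to `η`. -/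
def extendLast {m N : ℕ} (A : EuclideanSpace ℝ (Fin m) →ₗ[ℝ] Minkowski N) (η : Minkowski N) :
    EuclideanSpace ℝ (Fin (m + 1)) →ₗ[ℝ] Minkowski N :=
  A ∘ₗ initCoords m + (EuclideanSpace.proj (Fin.last m) : _ →L[ℝ] ℝ).toLinearMap.smulRight η

theorem extendLast_apply {m N : ℕ} (A : EuclideanSpace ℝ (Fin m) →ₗ[ℝ] Minkowski N)
    (η : Minkowski N) (x : EuclideanSpace ℝ (Fin (m + 1))) :
    extendLast A η x = A (initCoords m x) + x (Fin.last m) • η := rfl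

theorem lorentz_extendLast {m N : ℕ} {A : EuclideanSpace ℝ (Fin m) →ₗ[ℝ] Minkowski N}
    {η : Minkowski N} (hA : ∀ u v, lorentz (A u) (A v) = inner ℝ u v)
    (hAη : ∀ u, lorentz (A u) η = 0) (x y : EuclideanSpace ℝ (Fin (m + 1))) :
    lorentz (extendLast A η x) (extendLast A η y) = ∑ i : Fin m, x i.castSucc * y i.castSucc
      + lorentz η η * (x (Fin.last m) * y (Fin.last m)) := by
  simp only [extendLast_apply, lorentz_add_left, lorentz_add_right, lorentz_smul_left,
    lorentz_smul_right, hA, hAη, lorentz_comm η (A _), inner_initCoords]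
  ring

/-- A normal vector in the span of the light-like vectors `o` and `ξ`. If `⟨o, ξ⟩ = 1`, then the
vectors with `ε = 1` and `ε = -1` are an orthonormal basis of this span. -/
def lightConeNormal {N : ℕ} (o ξ : Minkowski N) (r ε : ℝ) : Minkowski N :=
  (r / 2) • o + (ε / r) • ξ

theorem lorentz_lightConeNormal_right {N : ℕ} (z o ξ : Minkowski N) (r ε : ℝ) :
    lorentz z (lightConeNormal o ξ r ε) = r / 2 * lorentz z o + ε / r * lorentz z ξ := by
  rw [lightConeNormal, lorentz_add_right, lorentz_smul_right, lorentz_smul_right]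

theorem univ_eq_pair {ι : Type*} [Fintype ι] [DecidableEq ι] {i j : ι}
    (hall : ∀ l, l = i ∨ l = j) : (Finset.univ : Finset ι) = {i, j} :=
  Finset.ext fun l => by simpa using hall l

section Splitting
variable {k : ℕ} {n : Fin k → ℕ} {N : ℕ} {o ξ : Minkowski (N + 1)}
  {A : ∀ i, EuclideanSpace ℝ (Fin (n i)) →ₗ[ℝ] Minkowski (N + 1)}

namespace IsLightConeFrame
variable (h : IsLightConeFrame o ξ A)
include h

theorem lorentz_o_lightConeNormal (r ε : ℝ) : lorentz o (lightConeNormal o ξ r ε) = ε / r := by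
  rw [lorentz_lightConeNormal_right, h.lorentz_o_o, h.lorentz_o_ξ, mul_zero, mul_one, zero_add]

theorem lorentz_A_lightConeNormal (r ε : ℝ) (i : Fin k) (u : EuclideanSpace ℝ (Fin (n i))) :
    lorentz (A i u) (lightConeNormal o ξ r ε) = 0 := by
  rw [lorentz_lightConeNormal_right, h.lorentz_A_o, h.lorentz_A_ξ, mul_zero, mul_zero, zero_add]

theorem lorentz_lightConeNormal {r : ℝ} (hr : r ≠ 0) (ε ε' : ℝ) :
    lorentz (lightConeNormal o ξ r ε) (lightConeNormal o ξ r ε') = (ε + ε') / 2 := by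
  rw [lorentz_lightConeNormal_right, lorentz_comm _ o, h.lorentz_o_lightConeNormal,
    lorentz_comm _ ξ, lorentz_lightConeNormal_right, lorentz_comm ξ o, h.lorentz_o_ξ,
    h.lorentz_ξ_ξ]
  field_simp
  ring

variable {i j : Fin k} (hij : i ≠ j) (hall : ∀ l, l = i ∨ l = j) {r : ℝ} (hr : r ≠ 0)
include hij hall hr

/-- For two factors `i` and `j`, the decomposition of `𝕃^(N+2)` into the span of the range of `A i`
and the time-like normal vector and the span of the range of `A j` and the space-like one. -/
def lorentzSplitting : LorentzSplitting N (n i) (n j) where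
  C := extendLast (A i) (lightConeNormal o ξ r (-1))
  D := extendLast (A j) (lightConeNormal o ξ r 1)
  dim := by rw [← h.dim, univ_eq_pair hall, Finset.sum_pair hij]
  lorentz_C x y := by
    rw [lorentz_extendLast (h.lorentz_A i) (h.lorentz_A_lightConeNormal r _ i),
      h.lorentz_lightConeNormal hr, lorentz]
    ring
  lorentz_D x y := by
    rw [lorentz_extendLast (h.lorentz_A j) (h.lorentz_A_lightConeNormal r _ j),
      h.lorentz_lightConeNormal hr, PiLp.inner_apply, Fin.sum_univ_castSucc]
    simp [mul_comm]
  lorentz_C_D x y := by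
    rw [extendLast_apply, extendLast_apply, lorentz_add_left, lorentz_add_right,
      lorentz_add_right, lorentz_smul_left, lorentz_smul_left, lorentz_smul_right,
      lorentz_smul_right, h.lorentz_A_of_ne i j hij, lorentz_comm _ (A j _),
      h.lorentz_A_lightConeNormal, h.lorentz_A_lightConeNormal, h.lorentz_lightConeNormal hr]
    ring

theorem lorentz_o_lorentzSplitting_C (X : Minkowski (n i)) :
    lorentz o ((h.lorentzSplitting hij hall hr).C X) = -X (Fin.last (n i)) / r := by
  change lorentz o (extendLast _ _ X) = _
  rw [extendLast_apply, lorentz_add_right, lorentz_comm, h.lorentz_A_o, lorentz_smul_right,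
    h.lorentz_o_lightConeNormal]
  ring

theorem lorentz_o_lorentzSplitting_D (Y : EuclideanSpace ℝ (Fin (n j + 1))) :
    lorentz o ((h.lorentzSplitting hij hall hr).D Y) = Y (Fin.last (n j)) / r := by
  change lorentz o (extendLast _ _ Y) = _
  rw [extendLast_apply, lorentz_add_right, lorentz_comm, h.lorentz_A_o, lorentz_smul_right,
    h.lorentz_o_lightConeNormal]
  ring

theorem projC_lorentzSplitting_o_last :
    (h.lorentzSplitting hij hall hr).projC o (Fin.last (n i)) = 1 / r := by
  have hlast := (h.lorentzSplitting hij hall hr).lorentz_projC o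
    (EuclideanSpace.single (Fin.last (n i)) 1)
  rw [h.lorentz_o_lorentzSplitting_C] at hlast
  simpa [lorentz, neg_div] using hlast

theorem projD_lorentzSplitting_o_last :
    (h.lorentzSplitting hij hall hr).projD o (Fin.last (n j)) = 1 / r := by
  have hlast := (h.lorentzSplitting hij hall hr).inner_projD o
    (EuclideanSpace.single (Fin.last (n j)) 1)
  rw [h.lorentz_o_lorentzSplitting_D] at hlast
  simpa [EuclideanSpace.inner_single_right] using hlast

theorem inner_projD_lorentzSplitting_o :
    inner ℝ ((h.lorentzSplitting hij hall hr).projD o) ((h.lorentzSplitting hij hall hr).projD o)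
      = 1 / r ^ 2 := by
  rw [LorentzSplitting.inner_projD, h.lorentz_o_lorentzSplitting_D,
    h.projD_lorentzSplitting_o_last]
  ring

end IsLightConeFrame
end Splitting

section Theta
variable {k : ℕ} {n : Fin k → ℕ} {N : ℕ} {o ξ : Minkowski (N + 1)}
  {A : ∀ i, EuclideanSpace ℝ (Fin (n i)) →ₗ[ℝ] Minkowski (N + 1)}
  {M : Fin k → Type*} [∀ i, TopologicalSpace (M i)]
  [∀ i, ChartedSpace (EuclideanSpace ℝ (Fin (n i))) (M i)] [∀ i, IsManifold (𝓡 (n i)) ∞ (M i)]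
  {g : ∀ i, RiemMetric (n i) (M i)} {G : ∀ i, M i → Minkowski (N + 1)}

namespace IsLightConeSplitting
variable (h : IsLightConeSplitting g o ξ G A)
include h

theorem lorentz_o_add_G_self (i : Fin k) (x : M i) : lorentz (o + G i x) (o + G i x) = 0 := by
  rw [lorentz_add_left, lorentz_add_right, lorentz_add_right, h.lorentz_o_o,
    lorentz_comm (G i x) o]
  linarith [h.lorentz_G_self i x]

theorem contMDiff_comp_o_add {Y : Type*} [NormedAddCommGroup Y] [NormedSpace ℝ Y] (i : Fin k)
    (P : Minkowski (N + 1) →L[ℝ] Y) :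
    ContMDiff (𝓡 (n i)) 𝓘(ℝ, Y) ∞ fun x => P (o + G i x) :=
  (P.contDiff.comp (contDiff_const.add contDiff_id)).contMDiff.comp (h.contMDiff i)

theorem mvfderiv_comp_o_add {Y : Type*} [NormedAddCommGroup Y] [NormedSpace ℝ Y] (i : Fin k)
    (P : Minkowski (N + 1) →L[ℝ] Y) {x : M i} (u : TangentSpace (𝓡 (n i)) x) :
    mvfderiv (𝓡 (n i)) (fun x => P (o + G i x)) x u = P (mvfderiv (𝓡 (n i)) (G i) x u) :=
  mvfderiv_comp_of_hasFDerivAt (h.mdifferentiableAt i x)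
    (P.hasFDerivAt.comp _ ((hasFDerivAt_id _).const_add o)) u

variable {m : ℕ} {i : Fin k} {c : ℝ}

section Hyperbolic
variable (S : LorentzSplitting N (n i) m) (hG : ∀ x Y, lorentz (G i x) (S.D Y) = 0)
  (ho : inner ℝ (S.projD o) (S.projD o) = 1 / c)
include hG

theorem lorentz_projC_mvfderiv (x : M i) (u v : TangentSpace (𝓡 (n i)) x) :
    lorentz (S.projC (mvfderiv (𝓡 (n i)) (G i) x u)) (S.projC (mvfderiv (𝓡 (n i)) (G i) x v))
      = (g i).inner x u v := by
  have hzero : S.projD (mvfderiv (𝓡 (n i)) (G i) x u) = 0 := S.projD_eq_zero fun Y =>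
    lorentz_mvfderiv_eq_zero (h.mdifferentiableAt i x) (fun x => hG x Y) u
  rw [← h.isometric, ← S.lorentz_projC_add_inner_projD, hzero, inner_zero_left, add_zero]

include ho

theorem lorentz_projC_o_add (x : M i) :
    lorentz (S.projC (o + G i x)) (S.projC (o + G i x)) = -1 / c := by
  have hsum := S.lorentz_projC_add_inner_projD (o + G i x) (o + G i x)
  rw [h.lorentz_o_add_G_self, map_add S.projD, S.projD_eq_zero (hG x), add_zero, ho] at hsum
  rw [neg_div]
  exact eq_neg_of_add_eq_zero_left hsum

theorem projC_o_add_last_pos [PreconnectedSpace (M i)] (hc : 0 < c)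
    (hlast : 0 < S.projC o (Fin.last (n i))) (x : M i) :
    0 < S.projC (o + G i x) (Fin.last (n i)) := by
  have hne : ∀ x, S.projC (o + G i x) (Fin.last (n i)) ≠ 0 := fun x =>
    last_ne_zero_of_lorentz_self_neg (by
      rw [h.lorentz_projC_o_add S hG ho]
      exact div_neg_of_neg_of_pos (by simp) hc)
  have hcont : Continuous fun x => S.projC (o + G i x) (Fin.last (n i)) :=
    (EuclideanSpace.proj (Fin.last (n i)) : Minkowski (n i) →L[ℝ] ℝ).continuous.comp
      (h.contMDiff_comp_o_add i S.projC).continuous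
  obtain ⟨x₀, hx₀⟩ := h.exists_eq_zero i
  by_contra! hx
  obtain ⟨y, hy⟩ := mem_range_of_exists_le_of_exists_ge hcont ⟨x, hx⟩
    ⟨x₀, by rw [hx₀, add_zero]; exact hlast.le⟩
  exact hne y hy

theorem isLocalIsometryHyperbolic_projC [PreconnectedSpace (M i)] (hc : 0 < c)
    (hlast : 0 < S.projC o (Fin.last (n i))) :
    IsLocalIsometryHyperbolic (g i) c fun x => S.projC (o + G i x) where
  mem x := ⟨h.lorentz_projC_o_add S hG ho x, h.projC_o_add_last_pos S hG ho hc hlast x⟩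
  contMDiff := h.contMDiff_comp_o_add i S.projC
  isometric x u v := by
    rw [h.mvfderiv_comp_o_add, h.mvfderiv_comp_o_add, h.lorentz_projC_mvfderiv S hG]

end Hyperbolic

theorem isLocalIsometrySphere_projD (S : LorentzSplitting N m (n i))
    (hG : ∀ x X, lorentz (G i x) (S.C X) = 0) (ho : inner ℝ (S.projD o) (S.projD o) = 1 / c) :
    IsLocalIsometrySphere (g i) c fun x => S.projD (o + G i x) where
  mem x := by
    have hsum := S.lorentz_projC_add_inner_projD (o + G i x) (o + G i x)
    rw [h.lorentz_o_add_G_self, map_add S.projC, S.projC_eq_zero (hG x), add_zero,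
      ← h.lorentz_o_o, ← S.lorentz_projC_add_inner_projD] at hsum
    exact (add_left_cancel hsum).trans ho
  contMDiff := h.contMDiff_comp_o_add i S.projD
  isometric x u v := by
    have hzero : S.projC (mvfderiv (𝓡 (n i)) (G i) x u) = 0 := S.projC_eq_zero fun X =>
      lorentz_mvfderiv_eq_zero (h.mdifferentiableAt i x) (fun x => hG x X) u
    rw [h.mvfderiv_comp_o_add, h.mvfderiv_comp_o_add, ← h.isometric,
      ← S.lorentz_projC_add_inner_projD, hzero, lorentz_zero_left, zero_add]

variable {j : Fin k} (hij : i ≠ j) (hall : ∀ l, l = i ∨ l = j) {r : ℝ} (hr : r ≠ 0)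

theorem lorentz_G_lorentzSplitting_D
    (hi : ∀ x, lorentz (G i x) ξ = -(r ^ 2 / 2) * lorentz (G i x) o) (x : M i)
    (Y : EuclideanSpace ℝ (Fin (n j + 1))) :
    lorentz (G i x) ((h.lorentzSplitting hij hall hr).D Y) = 0 := by
  change lorentz (G i x) (extendLast _ _ Y) = 0
  rw [extendLast_apply, lorentz_add_right, lorentz_comm _ (A j _), h.lorentz_A_G hij.symm,
    lorentz_smul_right, lorentz_lightConeNormal_right, hi]
  field_simp
  ring

theorem lorentz_G_lorentzSplitting_C
    (hj : ∀ y, lorentz (G j y) ξ = r ^ 2 / 2 * lorentz (G j y) o) (y : M j)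
    (X : Minkowski (n i)) :
    lorentz (G j y) ((h.lorentzSplitting hij hall hr).C X) = 0 := by
  change lorentz (G j y) (extendLast _ _ X) = 0
  rw [extendLast_apply, lorentz_add_right, lorentz_comm _ (A i _), h.lorentz_A_G hij,
    lorentz_smul_right, lorentz_lightConeNormal_right, hj]
  field_simp
  ring

end IsLightConeSplitting

theorem eq_conformalTheta_of_smul_embed {m m' : ℕ} (T : LightConeTriple N)
    (S : LorentzSplitting N m m') {c ρ : ℝ} (hρ : ρ ≠ 0) {x : EuclideanSpace ℝ (Fin N)}
    {q : Minkowski m × EuclideanSpace ℝ (Fin (m' + 1))} (hq₁ : q.1 ∈ hyperbolic m c)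
    (hq₂ : q.2 ∈ roundSphere m' c) (hq : S.C q.1 + S.D q.2 = ρ • T.embed x) :
    q ∈ thetaDomain T S c ∧ x = conformalTheta T S q := by
  refine ⟨⟨hq₁, hq₂, ?_⟩, ?_⟩
  · rwa [hq, lorentz_smul_left, T.lorentz_embed_w, mul_one]
  · rw [conformalTheta, hq, T.toEuclidean_smul_embed hρ]

/-- The second alternative of the theorem: there are two factors, and `f` is the composition of a
map `Θ` with the product of local isometries into a hyperbolic space and a sphere. -/
def HasThetaForm (g : ∀ i, RiemMetric (n i) (M i))
    (f : (∀ i, M i) → EuclideanSpace ℝ (Fin N)) : Prop :=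
  k = 2 ∧ ∃ i j : Fin k, i ≠ j ∧ ∃ c : ℝ, 0 < c ∧
    ∃ (f₁ : M i → Minkowski (n i)) (f₂ : M j → EuclideanSpace ℝ (Fin (n j + 1)))
      (T : LightConeTriple N) (S : LorentzSplitting N (n i) (n j)),
      IsLocalIsometryHyperbolic (g i) c f₁ ∧ IsLocalIsometrySphere (g j) c f₂ ∧
      IsConformalDiffeoOn (thetaDomain T S c) (conformalTheta T S) ∧
      ∀ p, (f₁ (p i), f₂ (p j)) ∈ thetaDomain T S c ∧
        f p = conformalTheta T S (f₁ (p i), f₂ (p j))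

theorem IsLightConeSplitting.hasThetaForm [∀ i, PreconnectedSpace (M i)]
    (h : IsLightConeSplitting g o ξ G A) (T : LightConeTriple N)
    {f : (∀ i, M i) → EuclideanSpace ℝ (Fin N)} {ρ : (∀ i, M i) → ℝ}
    (hf : ∀ p, ρ p • T.embed (f p) = o + ∑ i, G i (p i)) (hρ : ∀ p, 0 < ρ p) {i j : Fin k}
    (hij : i ≠ j) (hall : ∀ l, l = i ∨ l = j) {r : ℝ} (hr : 0 < r)
    (hi : ∀ x, lorentz (G i x) ξ = -(r ^ 2 / 2) * lorentz (G i x) o)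
    (hj : ∀ y, lorentz (G j y) ξ = r ^ 2 / 2 * lorentz (G j y) o) : HasThetaForm g f := by
  have huniv := univ_eq_pair hall
  have hk : k = 2 := by
    rw [← Fintype.card_fin k, ← Finset.card_univ, huniv, Finset.card_pair hij]
  let S := h.lorentzSplitting hij hall hr.ne'
  have hc : 0 < r ^ 2 := pow_pos hr 2
  have ho := h.inner_projD_lorentzSplitting_o hij hall hr.ne'
  have hlast : 0 < S.projC o (Fin.last (n i)) :=
    (h.projC_lorentzSplitting_o_last hij hall hr.ne').symm ▸ one_div_pos.2 hr
  have hGi := h.lorentz_G_lorentzSplitting_D hij hall hr.ne' hi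
  have hGj := h.lorentz_G_lorentzSplitting_C hij hall hr.ne' hj
  have h₁ := h.isLocalIsometryHyperbolic_projC S hGi ho hc hlast
  have h₂ := h.isLocalIsometrySphere_projD S hGj ho
  refine ⟨hk, i, j, hij, r ^ 2, hc, _, _, T, S, h₁, h₂,
    isConformalDiffeoOn_conformalTheta T S hc, fun p =>
      eq_conformalTheta_of_smul_embed T S (hρ p).ne' (h₁.mem _) (h₂.mem _) ?_⟩
  have hC : S.projC (o + ∑ l, G l (p l)) = S.projC (o + G i (p i)) := by
    rw [huniv, Finset.sum_pair hij, ← add_assoc, map_add, S.projC_eq_zero (hGj _), add_zero]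
  have hD : S.projD (o + ∑ l, G l (p l)) = S.projD (o + G j (p j)) := by
    rw [huniv, Finset.sum_pair hij, add_left_comm, map_add, S.projD_eq_zero (hGi _), zero_add]
  rw [← hC, ← hD, S.C_projC_add_D_projD, hf]

end Theta
end

theorem corollary4p4_general {k : ℕ} (hk : 2 ≤ k) {n : Fin k → ℕ} (hn : ∀ i, 1 ≤ n i)
    {N : ℕ} (hN : ∑ i, n i = N) (hN3 : 3 ≤ N)
    {M : Fin k → Type*} [∀ i, TopologicalSpace (M i)] [∀ i, ConnectedSpace (M i)]
    [∀ i, ChartedSpace (EuclideanSpace ℝ (Fin (n i))) (M i)]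
    [∀ i, IsManifold (𝓡 (n i)) ∞ (M i)]
    {g : ∀ i, RiemMetric (n i) (M i)}
    {f : (∀ i, M i) → EuclideanSpace ℝ (Fin N)} (hf : IsConformalLocalDiffeo g f) :
    HasSimilarityForm g f ∨ HasThetaForm g f := by
  let T := LightConeTriple.std N
  let p₀ : ∀ i, M i := fun _ => Classical.arbitrary _
  obtain ⟨ρ, G, hρ, hfG, hG₀, hG, hiso⟩ := exists_lightCone_splitting T hk hn hN hN3 hf p₀
  have ho : ρ p₀ • T.embed (f p₀) ≠ 0 := smul_ne_zero (hρ p₀).ne' fun hzero => by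
    simpa [hzero] using T.lorentz_embed_w (f p₀)
  have hnull : ∀ p : ∀ i, M i, lorentz (ρ p₀ • T.embed (f p₀) + ∑ i, G i (p i))
      (ρ p₀ • T.embed (f p₀) + ∑ i, G i (p i)) = 0 := fun p => by
    rw [← hfG, lorentz_smul_left, lorentz_smul_right, T.lorentz_embed_self, mul_zero, mul_zero]
  obtain ⟨ξ, A, h⟩ := exists_isLightConeSplitting hN ho hnull hG₀ hG hiso
  rcases h.lorentz_ξ_eq_zero_or_exists_pair hk hn with hξ | ⟨i, j, hij, hall, μ, hμ, hi, hj⟩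
  · exact Or.inl (h.hasSimilarityForm hξ T hfG hρ)
  · obtain ⟨r, hr, rfl⟩ : ∃ r : ℝ, 0 < r ∧ r ^ 2 / 2 = μ :=
      ⟨√(2 * μ), Real.sqrt_pos.2 (by linarith), by rw [Real.sq_sqrt (by linarith)]; ring⟩
    exact Or.inr (h.hasThetaForm T hfG hρ hij hall hr hi hj)

theorem corollary4p4 {k : ℕ} (hk : 2 ≤ k) {n : Fin k → ℕ} (hn : ∀ i, 1 ≤ n i)
    {N : ℕ} (hN : ∑ i, n i = N) (hN3 : 3 ≤ N)
    {M : Fin k → Type*} [∀ i, TopologicalSpace (M i)] [∀ i, T2Space (M i)]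
    [∀ i, SecondCountableTopology (M i)] [∀ i, ConnectedSpace (M i)]
    [∀ i, ChartedSpace (EuclideanSpace ℝ (Fin (n i))) (M i)]
    [∀ i, IsManifold (𝓡 (n i)) ∞ (M i)]
    (g : ∀ i, RiemMetric (n i) (M i))
    (f : (∀ i, M i) → EuclideanSpace ℝ (Fin N)) (hf : IsConformalLocalDiffeo g f) :
    -- first form: the inversion may be absent
    (∃ (Φ : PiLp 2 (fun i => EuclideanSpace ℝ (Fin (n i))) ≃ᵢ EuclideanSpace ℝ (Fin N))
        (F : ∀ i, M i → EuclideanSpace ℝ (Fin (n i)))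
        (H : EuclideanSpace ℝ (Fin N) → EuclideanSpace ℝ (Fin N)),
      (∀ i, IsLocalIsometryEuclidean (g i) (F i)) ∧
      (∃ (a : EuclideanSpace ℝ (Fin N)) (r : ℝ), 0 < r ∧ H = AffineMap.homothety a r) ∧
      ((∀ p, f p = H (Φ (WithLp.toLp 2 fun i => F i (p i)))) ∨
        ∃ (b : EuclideanSpace ℝ (Fin N)) (s : ℝ), 0 < s ∧
          ∀ p, H (Φ (WithLp.toLp 2 fun i => F i (p i))) ≠ b ∧
            f p = EuclideanGeometry.inversion b s (H (Φ (WithLp.toLp 2 fun i => F i (p i)))))) ∨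
    -- second form
    (k = 2 ∧ ∃ i j : Fin k, i ≠ j ∧ ∃ c : ℝ, 0 < c ∧
      ∃ (f₁ : M i → Minkowski (n i)) (f₂ : M j → EuclideanSpace ℝ (Fin (n j + 1)))
        (T : LightConeTriple N) (S : LorentzSplitting N (n i) (n j)),
        IsLocalIsometryHyperbolic (g i) c f₁ ∧ IsLocalIsometrySphere (g j) c f₂ ∧
        IsConformalDiffeoOn (thetaDomain T S c) (conformalTheta T S) ∧
        ∀ p, (f₁ (p i), f₂ (p j)) ∈ thetaDomain T S c ∧
          f p = conformalTheta T S (f₁ (p i), f₂ (p j))) :=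
  corollary4p4_general hk hn hN hN3 hf
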